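/- **Setting.** A *semi-Markovian causal model* over a finite set $\mathbf V$ of observed variables, each with a finite non-empty domain, consists of finitely many mutually independent unobserved random variables $\mathbf U$ (with arbitrary domains and laws) and, for each $V_i\in\mathbf V$, a function $f_{V_i}$ that determines the value of $V_i$ and is defined in terms of a subset of $\mathbf V$ (its observed parents) and a subset of $\mathbf U$. Each $U\in\mathbf U$ appears in at most two of the functions, and the directed graph of observed parents is acyclic. The model *induces* the semi-Markovian graph (SMG) on $\mathbf V$ that has an edge $V_i\to V_j$ exactly when $f_{V_j}$ is defined in terms of $V_i$, and an edge $V_i\leftrightarrow V_j$ ($i\ne j$) exactly when $f_{V_i}$ and $f_{V_j}$ share an unobserved variable. $P_{\mathbf x}(\mathbf y)$ denotes the distribution of $\mathbf Y$ in the sub-model in which the functions of the variables in $\mathbf X$ are replaced with the constants $\mathbf x$. For an SMG $G$ on $\mathbf V$ and disjoint $\mathbf X,\mathbf Y\subseteq\mathbf O\subseteq\mathbf V$, the causal effect of $\mathbf X$ on $\mathbf Y$ is *identifiable from $P(\mathbf O)$ in $G$* if any two semi-Markovian causal models that induce $G$, have the same domains, and have the same distribution $P(\mathbf o)$ of $\mathbf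 O$, with $P(\mathbf o)>0$ for all $\mathbf o$, have the same $P_{\mathbf x}(\mathbf y)$ for all $\mathbf x$, $\mathbf y$. For an SMG $G$ on $\mathbf V$ and $\mathbf Z\subseteq\mathbf V$, replace each bidirected edge $A\leftrightarrow B$ of $G$ by a new vertex $U$ with edges $A\leftarrow U\to B$, and call the vertices in $\mathbf Z$ and the new vertices latent. The *latent projection* $L(G,\mathbf V\setminus\mathbf Z)$ is the SMG on $\mathbf V\setminus\mathbf Z$ such that, for distinct $A,B\in\mathbf V\setminus\mathbf Z$: it has the edge $A\to B$ exactly when there is a directed path from $A$ to $B$ on which every vertex other than $A$ and $B$ is latent; and it has the edge $A\leftrightarrow B$ exactly when there is a path between $A$ and $B$ without colliders $I\to M\leftarrow J$, on which every vertex other than $A$ and $B$ is latent, and whose first and last edges point into $A$ and into $B$. **Lemma.** Let $G$ be an SMG on $\mathbf V$ and let $\mathbf X,\mathbf Y,\mathbf Z\subseteq\mathbf V$ be pairwise disjoint. Put $P'=P(\mathbf V\setminus\mathbf Z)$. Then the causal effect of $\mathbf X$ on $\mathbf Y$ is identifiable from $P'$ in the latent projection $L(G,\mathbf V\setminus\mathbf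 Z)$ if and only if it is identifiable from $P'$ in $G$. -/

import Mathlib

open MeasureTheory
open scoped ENNReal

/-- A directed acyclic graph on the vertex type `W`. -/
structure DAG (W : Type) where
  /-- `edge a b` says that there is an edge `a → b`. -/
  edge : W → W → Prop
  acyclic : ∀ a, ¬ Relation.TransGen edge a a

/-- A semi-Markovian graph on the vertex type `V`: directed edges, which form a DAG, and
bidirected edges between pairs of distinct vertices. -/
structure SMG (V : Type) extends DAG V where
  /-- `bidirected.Adj a b` says that there is an edge `a ↔ b`. -/
  bidirected : SimpleGraph V

namespace DAG

variable {W : Type}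

/-- The list `p` is a directed path with at least one edge from `a` to `b`, on which every vertex
other than `a` and `b` is latent, that is, outside the set `O` of observed vertices. -/
def IsDirectedLatentPath (G : DAG W) (O : Set W) (a b : W) (p : List W) : Prop :=
  p.head? = some a ∧ p.getLast? = some b ∧ p.IsChain G.edge ∧
    ∀ m ∈ p, m ≠ a → m ≠ b → m ∉ O

/-- The list `p` contains a collider `i → m ← j`. -/
def HasCollider (G : DAG W) (p : List W) : Prop :=
  ∃ i m j, [i, m, j] <:+: p ∧ G.edge i m ∧ G.edge j m

/-- The list `p` is a path (edges may be traversed in both directions, vertices do not repeat)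
from `a` to `b` without colliders, whose first edge points into `a` and whose last edge points
into `b`, and on which every vertex other than `a` and `b` is outside the set `O` of observed
vertices. -/
def IsConfoundingPath (G : DAG W) (O : Set W) (a b : W) (p : List W) : Prop :=
  p.Nodup ∧ p.IsChain (fun i j => G.edge i j ∨ G.edge j i) ∧
    (∃ m, [a, m] <+: p ∧ G.edge m a) ∧ (∃ m, [m, b] <:+ p ∧ G.edge m b) ∧
    ¬ G.HasCollider p ∧ ∀ m ∈ p, m ≠ a → m ≠ b → m ∉ O

/-- The directed edges of the latent projection of `G` on the set `O` of observed vertices. -/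
def ProjDirected (G : DAG W) (O : Set W) (a b : W) : Prop :=
  a ≠ b ∧ ∃ p, G.IsDirectedLatentPath O a b p

/-- The bidirected edges of the latent projection of `G` on the set `O` of observed vertices. -/
def ProjBidirected (G : DAG W) (O : Set W) (a b : W) : Prop :=
  a ≠ b ∧ ∃ p, G.IsConfoundingPath O a b p

theorem ProjDirected.transGen {G : DAG W} {O : Set W} {a b : W} (h : G.ProjDirected O a b) :
    Relation.TransGen G.edge a b := by
  obtain ⟨hab, p, h1, h2, h3, -⟩ := h
  cases p with
  | nil => simp at h1
  | cons c l =>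
    obtain rfl : c = a := by simpa using h1
    have hr : Relation.ReflTransGen G.edge c b := by
      have := List.relationReflTransGen_of_exists_isChain_cons l h3
        (b := b) (by simpa [List.getLast?_eq_some_getLast] using h2)
      exact this
    rcases Relation.reflTransGen_iff_eq_or_transGen.1 hr with h | h
    · exact absurd h.symm hab
    · exact h

theorem ProjBidirected.symm {G : DAG W} {O : Set W} {a b : W} (h : G.ProjBidirected O a b) :
    G.ProjBidirected O b a := by
  obtain ⟨hab, p, h1, h2, ⟨m, hm, hm'⟩, ⟨n, hn, hn'⟩, h5, h6⟩ := h
  refine ⟨hab.symm, p.reverse, by simpa using h1, ?_, ⟨n, ?_, hn'⟩, ⟨m, ?_, hm'⟩, ?_, ?_⟩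
  · rw [List.isChain_reverse]
    exact h2.imp fun _ _ h => h.symm
  · simpa using List.reverse_prefix.2 hn
  · simpa using List.reverse_suffix.2 hm
  · rintro ⟨i, k, j, hi, h7, h8⟩
    refine h5 ⟨j, k, i, ?_, h8, h7⟩
    have := List.reverse_infix.2 hi
    simpa using this
  · intro k hk hb ha
    exact h6 k (by simpa using hk) ha hb

end DAG

namespace SMG

variable {V : Type}

/-- The DAG that the semi-Markovian graph `G` abbreviates: each bidirected edge `a ↔ b` stands for
an unobserved vertex `u` with the two edges `a ← u → b`. -/
def toExplicitDAG (G : SMG V) : DAG (V ⊕ G.bidirected.edgeSet) where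
  edge s t := match s, t with
    | .inl a, .inl b => G.edge a b
    | .inr e, .inl b => b ∈ (e : Sym2 V)
    | _, .inr _ => False
  acyclic := by
    have key : ∀ s t : V ⊕ G.bidirected.edgeSet, Relation.TransGen (fun s t =>
        match s, t with
        | .inl a, .inl b => G.edge a b
        | .inr e, .inl b => b ∈ (e : Sym2 V)
        | _, .inr _ => False) s t →
        ∃ b, t = .inl b ∧ ∀ a, s = .inl a → Relation.TransGen G.edge a b := by
      intro s t h
      induction h with
      | @single t h =>
        rcases s with a | e <;> rcases t with b | e' <;> simp at h ⊢
        exact .single h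
      | @tail t t' _ h ih =>
        obtain ⟨b, rfl, hb⟩ := ih
        rcases t' with c | e'
        · exact ⟨c, rfl, fun a ha => (hb a ha).tail h⟩
        · exact h.elim
    intro s h
    obtain ⟨b, rfl, hb⟩ := key s s h
    exact G.acyclic b (hb b rfl)

/-- The latent projection `L(G, V ∖ Z)` of a semi-Markovian graph: the vertices in `V ∖ Z` are
observed; the vertices in `Z`, and those that the bidirected edges stand for, are latent. -/
def latentProjection (G : SMG V) (Z : Set V) : SMG {v : V // v ∉ Z} where
  edge a b := G.toExplicitDAG.ProjDirected (Sum.inl '' Zᶜ) (.inl a.1) (.inl b.1)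
  acyclic a h := by
    have key : ∀ a b : {v : V // v ∉ Z}, Relation.TransGen (fun a b : {v : V // v ∉ Z} =>
        G.toExplicitDAG.ProjDirected (Sum.inl '' Zᶜ) (.inl a.1) (.inl b.1)) a b →
        Relation.TransGen G.toExplicitDAG.edge (.inl a.1) (.inl b.1) := by
      intro a b h
      induction h with
      | single h => exact h.transGen
      | tail _ h ih => exact ih.trans h.transGen
    exact G.toExplicitDAG.acyclic _ (key a a h)
  bidirected :=
    { Adj := fun a b => G.toExplicitDAG.ProjBidirected (Sum.inl '' Zᶜ) (.inl a.1) (.inl b.1)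
      symm := ⟨fun _ _ h => h.symm⟩
      loopless := ⟨fun _ h => h.1 rfl⟩ }

end SMG

/-- A semi-Markovian causal model with observed (endogenous) variables `V`, where `v` takes values
in `D v`. -/
structure CausalModel (V : Type) (D : V → Type) where
  /-- The unobserved (exogenous) variables. -/
  U : Type
  [fintypeU : Fintype U]
  /-- The domains of the unobserved variables. -/
  Ω : U → Type
  [measurableSpaceΩ : ∀ e, MeasurableSpace (Ω e)]
  /-- The distributions of the unobserved variables. These variables are mutually independent, so
  that their joint distribution is the product `Measure.pi law`. -/
  law : ∀ e, Measure (Ω e)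
  [isProbabilityMeasure_law : ∀ e, IsProbabilityMeasure (law e)]
  /-- The observed variables in terms of which the function of `v` is defined. -/
  paV : V → Set V
  /-- The unobserved variables in terms of which the function of `v` is defined. -/
  paU : V → Set U
  /-- The function that determines the value of `v`. -/
  f : ∀ v, (∀ w, D w) → (∀ e, Ω e) → D v
  f_congr : ∀ v a a' u u', (∀ w ∈ paV v, a w = a' w) → (∀ e ∈ paU v, u e = u' e) →
    f v a u = f v a' u'
  measurable_f : ∀ v a, Measurable[MeasurableSpace.pi, ⊤] (f v a)
  acyclic : ∀ v, ¬ Relation.TransGen (fun a b => a ∈ paV b) v v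
  /-- Each unobserved variable appears in at most two of the functions. -/
  card_children : ∀ e, {v | e ∈ paU v}.encard ≤ 2

namespace CausalModel

attribute [instance] fintypeU measurableSpaceΩ isProbabilityMeasure_law

variable {V : Type} {D : V → Type}

/-- The model `M` induces the semi-Markovian graph `G`: the directed edges are the pairs `a → b`
for which the function of `b` is defined in terms of `a`, and the bidirected edges are the pairs of
distinct variables whose functions share an unobserved variable. -/
def Induces (M : CausalModel V D) (G : SMG V) : Prop :=
  (∀ a b, G.edge a b ↔ a ∈ M.paV b) ∧
    ∀ a b, G.bidirected.Adj a b ↔ a ≠ b ∧ ∃ e, e ∈ M.paU a ∧ e ∈ M.paU b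

/-- The functions of a model form a mapping from the unobserved to the observed variables. -/
theorem existsUnique_solution [Finite V] [∀ v, Nonempty (D v)] (M : CausalModel V D)
    (u : ∀ e, M.Ω e) : ∃! a : ∀ v, D v, ∀ v, a v = M.f v a u := by
  classical
  have wf : WellFounded (fun a b => a ∈ M.paV b) := by
    have : Std.Irrefl (Relation.TransGen (fun a b => a ∈ M.paV b)) := ⟨M.acyclic⟩
    have wf' := Finite.wellFounded_of_trans_of_irrefl
      (Relation.TransGen (fun a b => a ∈ M.paV b))
    exact Subrelation.wf (r := Relation.TransGen (fun a b => a ∈ M.paV b))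
      (fun {_ _} h => Relation.TransGen.single h) wf'
  let F : ∀ v, (∀ w, w ∈ M.paV v → D w) → D v := fun v r =>
    M.f v (fun w => if h : w ∈ M.paV v then r w h else Classical.arbitrary _) u
  refine ⟨wf.fix F, fun v => ?_, fun b hb => ?_⟩
  · conv_lhs => rw [wf.fix_eq]
    exact M.f_congr _ _ _ _ _ (fun w hw => by simp [hw]) (fun _ _ => rfl)
  · funext v
    induction v using wf.induction with
    | _ v ih =>
      rw [hb v, wf.fix_eq]
      exact M.f_congr _ _ _ _ _ (fun w hw => by simp [hw, ih w hw]) (fun _ _ => rfl)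

/-- The values of the observed variables that result from the values `u` of the unobserved ones. -/
noncomputable def solution [Finite V] [∀ v, Nonempty (D v)] (M : CausalModel V D)
    (u : ∀ e, M.Ω e) : ∀ v, D v :=
  (M.existsUnique_solution u).choose

/-- The probability `P(s)` that the variables in `S` take the values prescribed by `s`
(only the values of `s` on `S` matter). -/
noncomputable def prob [Finite V] [∀ v, Nonempty (D v)] (M : CausalModel V D)
    (S : Set V) (s : ∀ v, D v) : ℝ≥0∞ :=
  Measure.pi M.law {u | ∀ v ∈ S, M.solution u v = s v}

open Classical in
/-- The sub-model `M_x` that results from the intervention `do(X = x)`: the functions that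
determine the variables in `X` are replaced with constants (only the values of `x` on `X`
matter). -/
noncomputable def intervene (M : CausalModel V D) (X : Set V) (x : ∀ v, D v) :
    CausalModel V D where
  U := M.U
  Ω := M.Ω
  law := M.law
  paV v := {w | v ∉ X ∧ w ∈ M.paV v}
  paU v := {e | v ∉ X ∧ e ∈ M.paU v}
  f v a u := if v ∈ X then x v else M.f v a u
  f_congr v a a' u u' ha hu := by
    by_cases hv : v ∈ X
    · simp [hv]
    · simp only [hv, if_false]
      exact M.f_congr v a a' u u' (fun w hw => ha w ⟨hv, hw⟩) (fun e he => hu e ⟨hv, he⟩)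
  measurable_f v a := by
    by_cases hv : v ∈ X
    · simp only [hv, if_true]
      exact @measurable_const _ _ ⊤ _ _
    · simp only [hv, if_false]
      exact M.measurable_f v a
  acyclic v h := M.acyclic v (Relation.TransGen.mono (fun _ _ hab => hab.2) _ _ h)
  card_children e := (Set.encard_le_encard fun _ hv => hv.2).trans (M.card_children e)

/-- The causal effect `P_x(y)` of `X` on `Y`. -/
noncomputable def causalEffect [Finite V] [∀ v, Nonempty (D v)] (M : CausalModel V D)
    (X : Set V) (x : ∀ v, D v) (Y : Set V) (y : ∀ v, D v) : ℝ≥0∞ :=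
  (M.intervene X x).prob Y y

end CausalModel

/-- The causal effect of `X` on `Y` is identifiable from the joint distribution `P(O)` of the
variables in `O` in the graph `G`: any two causal models that induce `G` and have the same positive
distribution of `O` have the same interventional distributions `P_x(y)`. -/
def SMG.Identifiable {V : Type} [Finite V] (G : SMG V) (O X Y : Set V) : Prop :=
  ∀ (D : V → Type) [∀ v, Finite (D v)] [∀ v, Nonempty (D v)] (M₁ M₂ : CausalModel V D),
    M₁.Induces G → M₂.Induces G →
    (∀ o, M₁.prob O o = M₂.prob O o) → (∀ o, 0 < M₁.prob O o) →
    ∀ x y, M₁.causalEffect X x Y y = M₂.causalEffect X x Y y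

/-!
The proof rests on the hedge criterion: the causal effect is identifiable from all observed
variables of a graph exactly when the graph has no hedge for it.

If there is no hedge, let `A` be the set of ancestors of `Y` that remain when the edges out of `X`
are cut. The effect is the marginal on `Y` of the c-factor of `A`, the probability that the
functions of the variables in `A` take given values when their arguments are held fixed. The
c-factor of everything is the observed distribution, and a known c-factor determines smaller ones: a
childless vertex can be summed out, and sets without bidirected edges between them split off by
positivity. A minimal set with known c-factor around a bidirected component of `A` is itself that
component, or it would yield a hedge. Marginalizing the variables in `Z` of a model of `G` gives
unobserved variables that may affect more than two observed ones, so that the argument is run for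
models with this generality; it then applies to `P(V ∖ Z)` in `G` with the hedges of the latent
projection.

If there is a hedge `C ⊆ T`, put a fair bit on every bidirected edge. In one model each vertex in
`T` sums the bits of its edges inside `T` and of its parents. In the other one, `C` ignores the rest
of `T`. In both models the only constraint on the observed values is one on a total parity, so that
they agree; setting `X ∩ T` to constants breaks the constraint in one model only. Rare noise bits
make the distribution positive. When the hedge is one of the latent projection, the vertices in `Z`
relay all the values that they receive, so that `G` simulates the two models.
-/

/-! ### Latent projections -/

namespace DAG

variable {W : Type} {K : DAG W} {O : Set W} {a b m w : W}

/-- There is a directed path, possibly without edges, from `w` to `b`, on which every vertex other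
than `b` is outside the set `O` of observed vertices. -/
def LatentAnc (K : DAG W) (O : Set W) : W → W → Prop :=
  Relation.ReflTransGen fun x y => x ∉ O ∧ K.edge x y

theorem LatentAnc.reflTransGen (h : K.LatentAnc O w b) : Relation.ReflTransGen K.edge w b :=
  Relation.ReflTransGen.mono (fun _ _ h => h.2) _ _ h

theorem LatentAnc.eq_of_mem (h : K.LatentAnc O w b) (hw : w ∈ O) : w = b := by
  rcases h.cases_head with h | ⟨c, hc, -⟩
  · exact h
  · exact absurd hw hc.1

theorem not_edge_of_reflTransGen (h : Relation.ReflTransGen K.edge a b) : ¬ K.edge b a :=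
  fun hba => K.acyclic a (.tail' h hba)

theorem wellFounded_edge [Finite W] (K : DAG W) : WellFounded K.edge := by
  have : Std.Irrefl (Relation.TransGen K.edge) := ⟨K.acyclic⟩
  exact Subrelation.wf (fun {_ _} h => Relation.TransGen.single h)
    (Finite.wellFounded_of_trans_of_irrefl (Relation.TransGen K.edge))

theorem wellFounded_swap_transGen [Finite W] (K : DAG W) :
    WellFounded (Function.swap (Relation.TransGen K.edge)) := by
  have : Std.Irrefl (Function.swap (Relation.TransGen K.edge)) := ⟨K.acyclic⟩
  have : IsTrans W (Function.swap (Relation.TransGen K.edge)) := ⟨fun _ _ _ h h' => h'.trans h⟩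
  exact Finite.wellFounded_of_trans_of_irrefl _

theorem pairwise_transGen_of_isChain {l : List W} (h : l.IsChain K.edge) :
    l.Pairwise (Relation.TransGen K.edge) :=
  (h.imp fun _ _ => Relation.TransGen.single).pairwise

theorem nodup_of_isChain {l : List W} (h : l.IsChain K.edge) : l.Nodup :=
  (pairwise_transGen_of_isChain h).imp fun {x _} hxy => by
    rintro rfl
    exact K.acyclic x hxy

theorem latentAnc_of_isChain {l : List W} (hl : (w :: l).IsChain K.edge)
    (hb : (w :: l).getLast? = some b) (hO : ∀ m ∈ w :: l, m ≠ b → m ∉ O) : K.LatentAnc O w b := by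
  induction l generalizing w with
  | nil =>
    obtain rfl : w = b := by simpa using hb
    exact .refl
  | cons x l ih =>
    have hb' : (x :: l).getLast? = some b := by simpa using hb
    have hwb : w ≠ b := by
      rintro rfl
      exact (List.nodup_cons.1 (nodup_of_isChain hl)).1 (List.mem_of_getLast? hb')
    obtain ⟨hwx, hl'⟩ := List.isChain_cons_cons.1 hl
    exact .head ⟨hO w List.mem_cons_self hwb, hwx⟩
      (ih hl' hb' fun m hm => hO m (List.mem_cons_of_mem _ hm))

theorem LatentAnc.exists_isChain (h : K.LatentAnc O w b) :
    ∃ l, (w :: l).IsChain K.edge ∧ (w :: l).getLast? = some b ∧ ∀ m ∈ w :: l, m ≠ b → m ∉ O := by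
  induction h using Relation.ReflTransGen.head_induction_on with
  | refl => exact ⟨[], by simp, by simp, by simp⟩
  | @head x y hxy _ ih =>
    obtain ⟨l, hl, hb, hO⟩ := ih
    exact ⟨y :: l, List.isChain_cons_cons.2 ⟨hxy.2, hl⟩, by simpa using hb,
      List.forall_mem_cons.2 ⟨fun _ => hxy.1, hO⟩⟩

theorem latentAnc_of_mem {l : List W} (hl : l.IsChain K.edge) (hb : l.getLast? = some b)
    (hO : ∀ m ∈ l, m ≠ b → m ∉ O) (hw : w ∈ l) : K.LatentAnc O w b := by
  obtain ⟨s, t, rfl⟩ := List.append_of_mem hw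
  exact latentAnc_of_isChain (hl.suffix (List.suffix_append _ _)) (by simpa using hb)
    fun m hm => hO m (List.mem_append_right _ hm)

theorem projDirected_iff :
    K.ProjDirected O a b ↔ a ≠ b ∧ ∃ w, K.edge a w ∧ K.LatentAnc O w b := by
  refine and_congr_right fun hab => ⟨?_, ?_⟩
  · rintro ⟨p, ha, hb, hp, hO⟩
    rcases p with - | ⟨c, - | ⟨d, l⟩⟩
    · simp at ha
    · simp only [List.head?_cons, List.getLast?_singleton] at ha hb
      exact absurd (Option.some_injective _ (ha.symm.trans hb)) hab
    · obtain rfl : c = a := by simpa using ha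
      have hc : ∀ m ∈ d :: l, m ≠ c := by
        rintro m hm rfl
        exact (List.nodup_cons.1 (nodup_of_isChain hp)).1 hm
      obtain ⟨hcd, hl⟩ := List.isChain_cons_cons.1 hp
      exact ⟨d, hcd, latentAnc_of_isChain hl (by simpa using hb)
        fun m hm => hO m (List.mem_cons_of_mem _ hm) (hc m hm)⟩
  · rintro ⟨w, haw, hwb⟩
    obtain ⟨l, hl, hb, hO⟩ := hwb.exists_isChain
    exact ⟨a :: w :: l, by simp, by simpa using hb, List.isChain_cons_cons.2 ⟨haw, hl⟩,
      List.forall_mem_cons.2 ⟨fun h => absurd rfl h, fun m hm _ => hO m hm⟩⟩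

theorem HasCollider.of_infix {p q : List W} (h : K.HasCollider p) (hpq : p <:+: q) :
    K.HasCollider q := by
  obtain ⟨i, m, j, hp, him, hjm⟩ := h
  exact ⟨i, m, j, hp.trans hpq, him, hjm⟩

theorem not_hasCollider_reverse_append {l r : List W} (hl : (m :: l).IsChain K.edge)
    (hr : (m :: r).IsChain K.edge) : ¬ K.HasCollider (l.reverse ++ m :: r) := by
  rintro ⟨i, k, j, ⟨s, t, hp⟩, hik, hjk⟩
  have hp' : s ++ [i] ++ k :: j :: t = l.reverse ++ m :: r := by simpa using hp
  rcases List.append_eq_append_iff.1 hp' with ⟨q, hq, hq'⟩ | ⟨q, -, hq⟩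
  · have hki : [k, i] <:+: m :: l := by
      rw [show m :: l = (l.reverse ++ [m]).reverse by simp, ← List.reverse_infix, hq,
        List.reverse_reverse]
      rcases q with - | ⟨k', q⟩
      · obtain ⟨rfl, -⟩ := List.cons_eq_cons.1 hq'
        exact ⟨s, [], by simp⟩
      · obtain ⟨rfl, -⟩ := List.cons_eq_cons.1 hq'
        exact ⟨s, q ++ [m], by simp⟩
    exact K.acyclic i (.tail (.single hik) (by simpa using hl.infix hki))
  · have hkj : [k, j] <:+: m :: r := ⟨q, t, by simp [hq]⟩
    exact K.acyclic j (.tail (.single hjk) (by simpa using hr.infix hkj))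

theorem exists_suffix_of_isChain {l : List W} (hl : (m :: l).IsChain K.edge)
    (ha : l.getLast? = some a) : ∃ n, [n, a] <:+ m :: l ∧ K.edge n a := by
  obtain ⟨l, rfl⟩ := List.getLast?_eq_some_iff.1 ha
  rw [← List.cons_append] at hl ⊢
  rcases List.eq_nil_or_concat' (m :: l) with h | ⟨q, n, h⟩
  · cases h
  · rw [h, List.append_assoc, List.singleton_append] at hl ⊢
    exact ⟨n, List.suffix_append _ _, by simpa using hl.right_of_append⟩

theorem exists_eq_reverse_append_of_not_hasCollider {p : List W} (hne : p ≠ [])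
    (hp : p.IsChain fun i j => K.edge i j ∨ K.edge j i) (hc : ¬ K.HasCollider p) :
    ∃ l m r, p = l.reverse ++ m :: r ∧ (m :: l).IsChain K.edge ∧ (m :: r).IsChain K.edge := by
  induction p with
  | nil => exact absurd rfl hne
  | cons c p ih =>
    rcases eq_or_ne p [] with rfl | hne'
    · exact ⟨[], c, [], by simp⟩
    obtain ⟨l, m, r, rfl, hl, hr⟩ := ih hne' hp.tail
      fun h => hc (h.of_infix (List.suffix_cons _ _).isInfix)
    rcases List.eq_nil_or_concat' l with rfl | ⟨l, d, rfl⟩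
    · rcases (List.isChain_cons_cons.1 hp).1 with hcm | hmc
      · exact ⟨[], c, m :: r, rfl, by simp, List.isChain_cons_cons.2 ⟨hcm, hr⟩⟩
      · exact ⟨[c], m, r, rfl, by simpa using hmc, hr⟩
    · have hdc : K.edge d c := by
        obtain ⟨n, ⟨q, hq⟩, hnd⟩ := exists_suffix_of_isChain hl List.getLast?_concat
        have hq' : d :: n :: q.reverse = d :: (l.reverse ++ [m]) := by
          simpa using congrArg List.reverse hq
        simp only [List.reverse_append, List.reverse_singleton, List.cons_append,
          List.isChain_cons_cons] at hp hc
        refine hp.1.resolve_left fun hcd => hc ⟨c, d, n, ⟨[], q.reverse ++ r, ?_⟩, hcd, hnd⟩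
        simpa using congrArg (· ++ r) hq'
      refine ⟨l ++ [d, c], m, r, by simp, ?_, hr⟩
      rw [← List.cons_append, List.isChain_split]
      exact ⟨hl, by simpa using hdc⟩

theorem getLast?_eq_of_prefix {l r : List W} {n : W} (hr : (m :: r).IsChain K.edge)
    (h : [a, n] <+: l.reverse ++ m :: r) (hna : K.edge n a) : l.getLast? = some a := by
  rcases List.eq_nil_or_concat' l with rfl | ⟨l, d, rfl⟩
  · have han : K.edge a n := by simpa using hr.infix h.isInfix
    exact absurd hna (not_edge_of_reflTransGen (.single han))
  · simp only [List.reverse_append, List.reverse_singleton, List.cons_append,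
      List.cons_prefix_cons] at h
    simp [h.1]

theorem isConfoundingPath_iff {p : List W} :
    K.IsConfoundingPath O a b p ↔ ∃ l m r, p = l.reverse ++ m :: r ∧ p.Nodup ∧
      (m :: l).IsChain K.edge ∧ l.getLast? = some a ∧
      (m :: r).IsChain K.edge ∧ r.getLast? = some b ∧ ∀ c ∈ p, c ≠ a → c ≠ b → c ∉ O := by
  constructor
  · rintro ⟨hnodup, hp, ⟨n, hn, hna⟩, ⟨n', hn', hnb⟩, hc, hO⟩
    obtain ⟨l, m, r, rfl, hl, hr⟩ := exists_eq_reverse_append_of_not_hasCollider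
      (by rintro rfl; simp at hn) hp hc
    have hn'' : [b, n'] <+: r.reverse ++ m :: l := by simpa using List.reverse_prefix.2 hn'
    exact ⟨l, m, r, rfl, hnodup, hl, getLast?_eq_of_prefix hr hn hna, hr,
      getLast?_eq_of_prefix hl hn'' hnb, hO⟩
  · rintro ⟨l, m, r, rfl, hnodup, hl, ha, hr, hb, hO⟩
    obtain ⟨n, hn, hna⟩ := exists_suffix_of_isChain hl ha
    obtain ⟨n', hn', hnb⟩ := exists_suffix_of_isChain hr hb
    refine ⟨hnodup, ?_, ⟨n, ?_, hna⟩, ⟨n', hn'.trans (List.suffix_append _ _), hnb⟩,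
      not_hasCollider_reverse_append hl hr, hO⟩
    · rw [List.isChain_split, ← List.reverse_cons, List.isChain_reverse]
      exact ⟨hl.imp fun _ _ => .inr, hr.imp fun _ _ => .inl⟩
    · simpa using (List.reverse_prefix.2 hn).trans (List.prefix_append _ r)

theorem exists_latentAnc_of_isConfoundingPath {p : List W} (h : K.IsConfoundingPath O a b p) :
    ∃ m, m ∉ O ∧ K.LatentAnc O m a ∧ K.LatentAnc O m b := by
  obtain ⟨l, m, r, rfl, hnodup, hl, ha, hr, hb, hO⟩ := isConfoundingPath_iff.1 h
  have hp : l.reverse ++ m :: r = (m :: l).reverse ++ r := by simp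
  have hal : ∀ c ∈ m :: r, c ≠ a := by
    rintro c hc rfl
    exact (List.nodup_append.1 hnodup).2.2 c (by simpa using List.mem_of_getLast? ha) c hc rfl
  have hbl : ∀ c ∈ m :: l, c ≠ b := by
    rintro c hc rfl
    rw [hp] at hnodup
    exact (List.nodup_append.1 hnodup).2.2 c (List.mem_reverse.2 hc) c
      (List.mem_of_getLast? hb) rfl
  refine ⟨m, hO m (by simp) (hal m (by simp)) (hbl m (by simp)),
    latentAnc_of_isChain hl (by simp [List.getLast?_cons, ha])
      fun c hc hca => hO c ?_ hca (hbl c hc),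
    latentAnc_of_isChain hr (by simp [List.getLast?_cons, hb])
      fun c hc => hO c (List.mem_append_right _ hc) (hal c hc)⟩
  rw [hp]
  exact List.mem_append_left _ (List.mem_reverse.2 hc)

theorem projBidirected_of_latentAnc [Finite W] (hab : a ≠ b) (ha : a ∈ O) (hb : b ∈ O)
    (hm : m ∉ O) (hma : K.LatentAnc O m a) (hmb : K.LatentAnc O m b) :
    K.ProjBidirected O a b := by
  -- A common latent ancestor without proper descendants of this kind gives a path without
  -- repeated vertices.
  obtain ⟨m, ⟨hm, hma, hmb⟩, hmin⟩ := K.wellFounded_swap_transGen.has_min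
    {m | m ∉ O ∧ K.LatentAnc O m a ∧ K.LatentAnc O m b} ⟨m, hm, hma, hmb⟩
  obtain ⟨l, hl, hla, hlO⟩ := hma.exists_isChain
  obtain ⟨r, hr, hrb, hrO⟩ := hmb.exists_isChain
  have getLast?_tail : ∀ {c : W} {q : List W}, c ∈ O → (m :: q).getLast? = some c →
      q.getLast? = some c := by
    rintro c (- | ⟨d, q⟩) hc hq
    · obtain rfl : m = c := by simpa using hq
      exact absurd hc hm
    · simpa using hq
  have hdisj : ∀ c ∈ l, c ∉ m :: r := by
    intro c hcl hcr
    have hmc : Relation.TransGen K.edge m c :=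
      List.rel_of_pairwise_cons (pairwise_transGen_of_isChain hl) hcl
    have hca := latentAnc_of_mem hl hla hlO (List.mem_cons_of_mem _ hcl)
    have hcb := latentAnc_of_mem hr hrb hrO hcr
    by_cases hc : c ∈ O
    · exact hab ((hca.eq_of_mem hc).symm.trans (hcb.eq_of_mem hc))
    · exact hmin c ⟨hc, hca, hcb⟩ hmc
  refine ⟨hab, l.reverse ++ m :: r, isConfoundingPath_iff.2 ⟨l, m, r, rfl, ?_, hl,
    getLast?_tail ha hla, hr, getLast?_tail hb hrb, fun c hc hca hcb => ?_⟩⟩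
  · rw [List.nodup_append, List.nodup_reverse]
    exact ⟨(List.nodup_cons.1 (nodup_of_isChain hl)).2, nodup_of_isChain hr,
      fun c hc d hd hcd => hdisj c (List.mem_reverse.1 hc) (hcd ▸ hd)⟩
  · rcases List.mem_append.1 hc with hc | hc
    · exact hlO c (List.mem_cons_of_mem _ (List.mem_reverse.1 hc)) hca
    · exact hrO c hc hcb

theorem projBidirected_iff [Finite W] (ha : a ∈ O) (hb : b ∈ O) :
    K.ProjBidirected O a b ↔ a ≠ b ∧ ∃ m, m ∉ O ∧ K.LatentAnc O m a ∧ K.LatentAnc O m b := by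
  constructor
  · rintro ⟨hab, p, hp⟩
    exact ⟨hab, exists_latentAnc_of_isConfoundingPath hp⟩
  · rintro ⟨hab, m, hm, hma, hmb⟩
    exact projBidirected_of_latentAnc hab ha hb hm hma hmb

end DAG

namespace SMG

variable {V : Type} {G : SMG V} {Z : Set V}

theorem latentAnc_inl_iff {w v : V} :
    G.toExplicitDAG.LatentAnc (Sum.inl '' Zᶜ) (.inl w) (.inl v) ↔ G.LatentAnc Zᶜ w v := by
  constructor
  · intro h
    generalize hs : (Sum.inl w : V ⊕ G.bidirected.edgeSet) = s at h
    induction h using Relation.ReflTransGen.head_induction_on generalizing w with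
    | refl =>
      obtain rfl := Sum.inl_injective hs
      exact .refl
    | @head x y hxy _ ih =>
      subst hs
      rcases y with y | e
      · exact .head ⟨fun h => hxy.1 ⟨w, h, rfl⟩, hxy.2⟩ (ih rfl)
      · exact hxy.2.elim
  · refine Relation.ReflTransGen.lift (p := fun s t => s ∉ Sum.inl '' Zᶜ ∧
      G.toExplicitDAG.edge s t) Sum.inl (fun x y hxy => ⟨?_, hxy.2⟩) w v
    simpa using hxy.1

theorem latentAnc_inr_iff {e : G.bidirected.edgeSet} {v : V} :
    G.toExplicitDAG.LatentAnc (Sum.inl '' Zᶜ) (.inr e) (.inl v) ↔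
      ∃ w ∈ (e : Sym2 V), G.LatentAnc Zᶜ w v := by
  constructor
  · intro h
    rcases h.cases_head with h | ⟨w | e', hc, h⟩
    · cases h
    · exact ⟨w, hc.2, latentAnc_inl_iff.1 h⟩
    · exact hc.2.elim
  · rintro ⟨w, hw, h⟩
    have hew : G.toExplicitDAG.edge (.inr e) (.inl w) := hw
    exact .head ⟨by simp, hew⟩ (latentAnc_inl_iff.2 h)

theorem latentProjection_edge {a b : {v : V // v ∉ Z}} :
    (G.latentProjection Z).edge a b ↔ ∃ w, G.edge a w ∧ G.LatentAnc Zᶜ w b := by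
  refine DAG.projDirected_iff.trans ⟨?_, ?_⟩
  · rintro ⟨-, w | e, haw, hwb⟩
    · exact ⟨w, haw, latentAnc_inl_iff.1 hwb⟩
    · exact haw.elim
  · rintro ⟨w, haw, hwb⟩
    refine ⟨fun h => ?_, .inl w, haw, latentAnc_inl_iff.2 hwb⟩
    rw [Sum.inl_injective h] at haw
    exact DAG.not_edge_of_reflTransGen hwb.reflTransGen haw

theorem latentProjection_adj [Finite V] {a b : {v : V // v ∉ Z}} :
    (G.latentProjection Z).bidirected.Adj a b ↔ a ≠ b ∧
      ((∃ z ∈ Z, G.LatentAnc Zᶜ z a ∧ G.LatentAnc Zᶜ z b) ∨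
        ∃ e : G.bidirected.edgeSet, ∃ w ∈ (e : Sym2 V), ∃ w' ∈ (e : Sym2 V),
          G.LatentAnc Zᶜ w a ∧ G.LatentAnc Zᶜ w' b) := by
  refine (DAG.projBidirected_iff (O := Sum.inl '' Zᶜ) (a := .inl a.1) (b := .inl b.1)
    ⟨a.1, a.2, rfl⟩ ⟨b.1, b.2, rfl⟩).trans (and_congr (by simp [Subtype.ext_iff]) ?_)
  simp only [Sum.exists, latentAnc_inl_iff, latentAnc_inr_iff]
  refine or_congr (exists_congr fun z => and_congr_left' (by simp)) (exists_congr fun e => ?_)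
  simp only [Set.mem_image, reduceCtorEq, and_false, exists_false, not_false_eq_true, true_and]
  constructor
  · rintro ⟨⟨w, hw, hwa⟩, w', hw', hwb⟩
    exact ⟨w, hw, w', hw', hwa, hwb⟩
  · rintro ⟨w, hw, w', hw', hwa, hwb⟩
    exact ⟨⟨w, hw, hwa⟩, w', hw', hwb⟩

end SMG

/-! ### Hedges and c-factors -/

section Independence

variable {E : Type*} {Ω : E → Type*} [∀ e, MeasurableSpace (Ω e)]

theorem exists_measurableSet_preimage_of_dependsOn [∀ e, Nonempty (Ω e)] {S : Set (∀ e, Ω e)}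
    (hS : MeasurableSet S) {I : Finset E} (hI : DependsOn (· ∈ S) (I : Set E)) :
    ∃ A : Set (∀ e : I, Ω e), MeasurableSet A ∧ S = (fun u (e : I) => u e) ⁻¹' A := by
  classical
  let u₀ : ∀ e, Ω e := fun e => Classical.arbitrary _
  refine ⟨Function.updateFinset u₀ I ⁻¹' S, hS.preimage measurable_updateFinset, ?_⟩
  ext u
  exact iff_of_eq (hI fun e he => by simp [Function.updateFinset, Finset.mem_coe.1 he])

theorem measure_pi_inter_of_dependsOn [Fintype E] (μ : ∀ e, Measure (Ω e))
    [∀ e, IsProbabilityMeasure (μ e)] {S S' : Set (∀ e, Ω e)} (hS : MeasurableSet S)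
    (hS' : MeasurableSet S') {I I' : Set E} (hI : DependsOn (· ∈ S) I) (hI' : DependsOn (· ∈ S') I')
    (hII' : Disjoint I I') :
    Measure.pi μ (S ∩ S') = Measure.pi μ S * Measure.pi μ S' := by
  classical
  have : ∀ e, Nonempty (Ω e) := fun e => (μ e).nonempty_of_neZero
  obtain ⟨A, hA, rfl⟩ := exists_measurableSet_preimage_of_dependsOn hS (I := I.toFinset)
    (by simpa using hI)
  obtain ⟨A', hA', rfl⟩ := exists_measurableSet_preimage_of_dependsOn hS' (I := I'.toFinset)
    (by simpa using hI')
  have hindep := ProbabilityTheory.iIndepFun_pi (μ := μ) (X := fun _ => id)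
    (fun _ => aemeasurable_id)
  exact (hindep.indepFun_finset I.toFinset I'.toFinset (Set.disjoint_toFinset.2 hII')
    measurable_pi_apply).measure_inter_preimage_eq_mul _ _ hA hA'

end Independence

theorem measure_preimage_eq_of_dependsOn {W : Type*} [Finite W] {D : W → Type*} [∀ v, Finite (D v)]
    [∀ v, Nonempty (D v)] {Ω₁ Ω₂ : Type*} [MeasurableSpace Ω₁] [MeasurableSpace Ω₂]
    {μ₁ : Measure Ω₁} {μ₂ : Measure Ω₂} {s₁ : Ω₁ → ∀ v, D v} {s₂ : Ω₂ → ∀ v, D v} {C : Set W}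
    (hs₁ : ∀ y : ∀ v, D v, MeasurableSet {u | ∀ v ∈ C, s₁ u v = y v})
    (hs₂ : ∀ y : ∀ v, D v, MeasurableSet {u | ∀ v ∈ C, s₂ u v = y v})
    (h : ∀ y : ∀ v, D v, μ₁ {u | ∀ v ∈ C, s₁ u v = y v} = μ₂ {u | ∀ v ∈ C, s₂ u v = y v})
    {R : Set (∀ v, D v)} (hR : DependsOn (· ∈ R) C) : μ₁ (s₁ ⁻¹' R) = μ₂ (s₂ ⁻¹' R) := by
  obtain ⟨A, rfl⟩ : ∃ A : Set (∀ v : C, D v), R = C.domRestrict ⁻¹' A :=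
    dependsOn_iff_exists_comp.1 hR
  have hA : A.Countable := A.to_countable
  have hfiber : ∀ c : ∀ v : C, D v, ∃ y : ∀ v, D v,
      (C.domRestrict ∘ s₁) ⁻¹' {c} = {u | ∀ v ∈ C, s₁ u v = y v} ∧
      (C.domRestrict ∘ s₂) ⁻¹' {c} = {u | ∀ v ∈ C, s₂ u v = y v} := by
    classical
    refine fun c => ⟨fun v => if hv : v ∈ C then c ⟨v, hv⟩ else Classical.arbitrary _, ?_, ?_⟩ <;>
    · ext u
      simp +contextual [funext_iff]
  choose y hy₁ hy₂ using hfiber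
  rw [← Set.preimage_comp, ← Set.preimage_comp,
    ← tsum_measure_preimage_singleton hA fun c _ => hy₁ c ▸ hs₁ (y c),
    ← tsum_measure_preimage_singleton hA fun c _ => hy₂ c ▸ hs₂ (y c)]
  simp only [hy₁, hy₂, h]

theorem preconnected_induce_iff {V : Type*} {G : SimpleGraph V} {T : Set V} :
    (G.induce T).Preconnected ↔
      ∀ S ⊆ T, S.Nonempty → S ≠ T → ∃ a ∈ S, ∃ b ∈ T \ S, G.Adj a b := by
  constructor
  · rintro h S hST ⟨a, ha⟩ hne
    obtain ⟨b, hb, hbS⟩ := Set.exists_of_ssubset (hST.ssubset_of_ne hne)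
    obtain ⟨p⟩ := h ⟨a, hST ha⟩ ⟨b, hb⟩
    obtain ⟨d, -, hd, hd'⟩ := p.exists_boundary_dart {v | v.1 ∈ S} ha hbS
    exact ⟨d.fst, hd, d.snd, ⟨d.snd.2, hd'⟩, d.adj⟩
  · intro h a b
    by_contra hab
    have hmem : ∀ v : T, v.1 ∈ Subtype.val '' {v : T | (G.induce T).Reachable a v} ↔
        (G.induce T).Reachable a v := fun v => Subtype.val_injective.mem_set_image
    obtain ⟨c, ⟨c, hc, rfl⟩, d, ⟨hdT, hd⟩, hcd⟩ := h _
      (Subtype.coe_image_subset T {v | (G.induce T).Reachable a v})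
      ⟨a, (hmem a).2 (.refl a)⟩ fun hS => hab ((hmem b).1 (hS.ge b.2))
    have hcd' : (G.induce T).Adj c ⟨d, hdT⟩ := hcd
    exact hd ((hmem ⟨d, hdT⟩).2 (hc.trans hcd'.reachable))

theorem subset_or_subset_sdiff_of_preconnected {V : Type*} {G : SimpleGraph V} {C S T : Set V}
    (hC : (G.induce C).Preconnected) (hCT : C ⊆ T) (hadj : ∀ a ∈ S, ∀ b ∈ T \ S, ¬ G.Adj a b) :
    C ⊆ S ∨ C ⊆ T \ S := by
  by_contra! h
  obtain ⟨hCS, hCTS⟩ := h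
  have hne : (C ∩ S).Nonempty := by
    obtain ⟨c, hc, hcTS⟩ := Set.not_subset.1 hCTS
    exact ⟨c, hc, by_contra fun hcS => hcTS ⟨hCT hc, hcS⟩⟩
  obtain ⟨a, ha, b, hb, hab⟩ := preconnected_induce_iff.1 hC (C ∩ S) Set.inter_subset_left hne
    fun h => hCS (Set.inter_eq_left.1 h)
  exact hadj a ha.2 b ⟨hCT hb.1, fun hbS => hb.2 ⟨hb.1, hbS⟩⟩ hab

namespace DAG

variable {W : Type} {K : DAG W} {S R A X Y : Set W}

/-- Every vertex in `S` outside `R` has a child in `S`. In a finite graph, every vertex in `S` then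
has a directed path to `R` inside `S`. -/
def IsRooted (K : DAG W) (S R : Set W) : Prop :=
  ∀ v ∈ S \ R, ∃ w ∈ S, K.edge v w

theorem exists_sink [Finite W] (K : DAG W) (hS : S.Nonempty) : ∃ v ∈ S, ∀ w ∈ S, ¬ K.edge v w := by
  obtain ⟨v, hv, hmax⟩ := K.wellFounded_swap_transGen.has_min S hS
  exact ⟨v, hv, fun w hw hvw => hmax w hw (.single hvw)⟩

theorem IsRooted.subset [Finite W] (hS : K.IsRooted S R) (hSX : Disjoint S X) (hRA : R ⊆ A)
    (hA : ∀ v w, w ∈ A → K.edge v w → v ∉ X → v ∈ A) : S ⊆ A := by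
  intro v
  induction v using K.wellFounded_swap_transGen.induction with
  | _ v ih =>
    intro hv
    by_cases hvR : v ∈ R
    · exact hRA hvR
    · obtain ⟨w, hw, hvw⟩ := hS v ⟨hv, hvR⟩
      exact hA v w (ih w (.single hvw) hw) hvw (Set.disjoint_left.1 hSX hv)

/-- The vertices with a directed path to `Y` that does not leave a vertex in `X`, that is, the
ancestors of `Y` in the graph without the edges out of `X`. -/
def ancestorsAvoiding (K : DAG W) (X Y : Set W) : Set W :=
  {v | ∃ w ∈ Y, K.LatentAnc X v w}

theorem subset_ancestorsAvoiding : Y ⊆ K.ancestorsAvoiding X Y :=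
  fun v hv => ⟨v, hv, .refl⟩

theorem disjoint_ancestorsAvoiding (hXY : Disjoint X Y) :
    Disjoint (K.ancestorsAvoiding X Y) X := by
  refine Set.disjoint_right.2 fun v hv ⟨w, hw, hvw⟩ => ?_
  obtain rfl := hvw.eq_of_mem hv
  exact Set.disjoint_left.1 hXY hv hw

theorem mem_ancestorsAvoiding_of_edge (v w : W) (hw : w ∈ K.ancestorsAvoiding X Y)
    (hvw : K.edge v w) (hv : v ∉ X) : v ∈ K.ancestorsAvoiding X Y := by
  obtain ⟨y, hy, hwy⟩ := hw
  exact ⟨y, hy, .head ⟨hv, hvw⟩ hwy⟩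

theorem isRooted_ancestorsAvoiding : K.IsRooted (K.ancestorsAvoiding X Y) Y := by
  rintro v ⟨⟨y, hy, hvy⟩, hv⟩
  rcases hvy.cases_head with rfl | ⟨w, hvw, hwy⟩
  · exact absurd hy hv
  · exact ⟨w, ⟨y, hy, hwy⟩, hvw.2⟩

end DAG

/-- A graphical obstruction to the identifiability of the causal effect of `X` on `Y`, cf. the
hedges of Shpitser and Pearl: two nested sets `C ⊆ T`, connected by bidirected edges and with `T`
rooted in `C`, such that `T` meets `X` and `C` has directed paths to `Y` inside a set `A` that
avoids `X`. -/
structure SMG.Hedge {W : Type} (H : SMG W) (X Y : Set W) where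
  C : Set W
  T : Set W
  A : Set W
  C_subset_T : C ⊆ T
  C_subset_A : C ⊆ A
  disjoint_A_X : Disjoint A X
  isRooted_T : H.IsRooted T C
  isRooted_A : H.IsRooted A Y
  connected_C : (H.bidirected.induce C).Connected
  connected_T : (H.bidirected.induce T).Connected
  nonempty_T_inter_X : (T ∩ X).Nonempty

/-- A model whose observed variables satisfy the constraints that the graph `H` imposes. In contrast
to a semi-Markovian model, an unobserved variable may affect any number of observed ones, as is the
case after the marginalization of observed variables. -/
structure LatentModel {W : Type} (H : SMG W) (D : W → Type) where
  U : Type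
  [fintypeU : Fintype U]
  Ω : U → Type
  [measurableSpaceΩ : ∀ e, MeasurableSpace (Ω e)]
  law : ∀ e, Measure (Ω e)
  [isProbabilityMeasure_law : ∀ e, IsProbabilityMeasure (law e)]
  paU : W → Set U
  f : ∀ v, (∀ w, D w) → (∀ e, Ω e) → D v
  f_congr : ∀ v a a' u u', (∀ w, H.edge w v → a w = a' w) → (∀ e ∈ paU v, u e = u' e) →
    f v a u = f v a' u'
  measurableSet_f : ∀ v a d, MeasurableSet {u | f v a u = d}
  adj : ∀ v w e, v ≠ w → e ∈ paU v → e ∈ paU w → H.bidirected.Adj v w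

namespace LatentModel

attribute [instance] fintypeU measurableSpaceΩ isProbabilityMeasure_law

variable {W : Type} {H : SMG W} {D : W → Type} {M : LatentModel H D} {A B C T X Y : Set W}
  {o x : ∀ v, D v}

/-- The event that the functions of the variables in `C` take the values prescribed by `o` when
their observed parents have the values prescribed by `o`. -/
def cEvent (M : LatentModel H D) (C : Set W) (o : ∀ v, D v) : Set (∀ e, M.Ω e) :=
  {u | ∀ v ∈ C, M.f v o u = o v}

/-- The c-factor `Q[C]` of Tian and Pearl, the interventional distribution of `C` under the
intervention on all other variables. -/
noncomputable def cFactor (M : LatentModel H D) (C : Set W) (o : ∀ v, D v) : ℝ≥0∞ :=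
  Measure.pi M.law (M.cEvent C o)

theorem measurableSet_cEvent [Finite W] (M : LatentModel H D) (C : Set W) (o : ∀ v, D v) :
    MeasurableSet (M.cEvent C o) := by
  simp only [cEvent, Set.ofPred_forall]
  exact .iInter fun v => .iInter fun _ => M.measurableSet_f v _ _

theorem dependsOn_cEvent (M : LatentModel H D) (C : Set W) (o : ∀ v, D v) :
    DependsOn (· ∈ M.cEvent C o) (⋃ v ∈ C, M.paU v) := by
  intro u u' hu
  refine propext (forall₂_congr fun v hv => ?_)
  rw [M.f_congr v o o u u' (fun _ _ => rfl) fun e he => hu e (Set.mem_biUnion hv he)]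

theorem cEvent_union : M.cEvent (A ∪ B) o = M.cEvent A o ∩ M.cEvent B o := by
  ext u
  simp only [cEvent, Set.mem_ofPred_eq, Set.mem_inter_iff, Set.mem_union, or_imp, forall_and]

theorem cFactor_anti (h : A ⊆ B) : M.cFactor B o ≤ M.cFactor A o :=
  measure_mono fun _ hu v hv => hu v (h hv)

theorem cFactor_empty : M.cFactor ∅ o = 1 := by
  simp [cFactor, cEvent]

theorem cFactor_union [Finite W] (hAB : Disjoint A B)
    (hadj : ∀ a ∈ A, ∀ b ∈ B, ¬ H.bidirected.Adj a b) :
    M.cFactor (A ∪ B) o = M.cFactor A o * M.cFactor B o := by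
  rw [cFactor, cEvent_union]
  refine measure_pi_inter_of_dependsOn M.law (M.measurableSet_cEvent A o)
    (M.measurableSet_cEvent B o) (M.dependsOn_cEvent A o) (M.dependsOn_cEvent B o) ?_
  simp only [Set.disjoint_iUnion_left, Set.disjoint_iUnion_right]
  exact fun b hb a ha => Set.disjoint_left.2 fun e hea heb =>
    hadj a ha b hb (M.adj a b e (hAB.ne_of_mem ha hb) hea heb)

open Classical in
theorem sum_cFactor_insert [Finite W] {v : W} [Fintype (D v)] (hv : v ∉ C)
    (hch : ∀ w ∈ C, ¬ H.edge v w) :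
    ∑ d, M.cFactor (insert v C) (Function.update o v d) = M.cFactor C o := by
  have hf : ∀ w ∈ insert v C, ∀ d u, M.f w (Function.update o v d) u = M.f w o u := by
    intro w hw d u
    refine M.f_congr _ _ _ _ _ (fun x hx => Function.update_of_ne ?_ _ _) fun _ _ => rfl
    rintro rfl
    rcases hw with rfl | hw
    · exact H.acyclic _ (.single hx)
    · exact hch w hw hx
  have hevent : ∀ d, M.cEvent (insert v C) (Function.update o v d) =
      {u | M.f v o u = d} ∩ M.cEvent C o := by
    intro d
    ext u
    simp only [cEvent, Set.mem_ofPred_eq, Set.forall_mem_insert, Set.mem_inter_iff,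
      hf v (.inl rfl), Function.update_self]
    refine and_congr_right fun _ => forall₂_congr fun w hw => ?_
    rw [hf w (.inr hw), Function.update_of_ne (ne_of_mem_of_not_mem hw hv)]
  simp only [cFactor, hevent]
  rw [← measure_biUnion_finset
    (fun d _ d' _ hdd' => Set.disjoint_left.2 fun u hu hu' => hdd' (hu.1.symm.trans hu'.1))
    fun d _ => (M.measurableSet_f v o d).inter (M.measurableSet_cEvent C o)]
  congr 1
  ext u
  simp

/-- The map `s` sends the values of the unobserved variables to those of the observed ones in the
sub-model in which the functions of the variables in `X` are replaced with the constants `x`. -/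
structure IsSolution (M : LatentModel H D) (X : Set W) (x : ∀ v, D v)
    (s : (∀ e, M.Ω e) → ∀ v, D v) : Prop where
  eq_f : ∀ u, ∀ v ∉ X, s u v = M.f v (s u) u
  eq_const : ∀ u, ∀ v ∈ X, s u v = x v

theorem IsSolution.setOf_eq_cEvent [Finite W] {s : (∀ e, M.Ω e) → ∀ v, D v}
    (hs : M.IsSolution X x s) (hAX : Disjoint A X)
    (hA : ∀ v w, w ∈ A → H.edge v w → v ∉ X → v ∈ A) (ho : ∀ v ∈ X, o v = x v) :
    {u | ∀ v ∈ A, s u v = o v} = M.cEvent A o := by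
  have hf : ∀ u, ∀ v ∈ A, (∀ w ∈ A, H.edge w v → s u w = o w) → s u v = M.f v o u := by
    intro u v hv hpa
    rw [hs.eq_f u v (Set.disjoint_left.1 hAX hv)]
    refine M.f_congr _ _ _ _ _ (fun w hw => ?_) fun _ _ => rfl
    by_cases hwX : w ∈ X
    · rw [ho w hwX, hs.eq_const u w hwX]
    · exact hpa w (hA w v hv hw hwX) hw
  ext u
  refine ⟨fun h v hv => ?_, fun h v => ?_⟩
  · rw [← hf u v hv fun w hw _ => h w hw, h v hv]
  · induction v using H.wellFounded_edge.induction with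
    | _ v ih => exact fun hv => (hf u v hv fun w hw hwv => ih w hwv hw).trans (h v hv)

variable [Finite W] {M₁ M₂ : LatentModel H D}

theorem cFactor_eq_of_union_of_eq (hpos : ∀ o, 0 < M₁.cFactor Set.univ o) (hAB : Disjoint A B)
    (hadj : ∀ a ∈ A, ∀ b ∈ B, ¬ H.bidirected.Adj a b)
    (h : M₁.cFactor (A ∪ B) = M₂.cFactor (A ∪ B)) (hB : M₁.cFactor B = M₂.cFactor B) :
    M₁.cFactor A = M₂.cFactor A := by
  funext o
  have ho := congrFun h o
  rw [cFactor_union hAB hadj, cFactor_union hAB hadj, ← hB] at ho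
  exact (ENNReal.mul_left_inj ((hpos o).trans_le (cFactor_anti (Set.subset_univ B))).ne'
    (measure_ne_top _ _)).1 ho

variable [∀ v, Finite (D v)]

theorem cFactor_eq_of_insert {v : W} (hv : v ∉ C) (hch : ∀ w ∈ C, ¬ H.edge v w)
    (h : M₁.cFactor (insert v C) = M₂.cFactor (insert v C)) : M₁.cFactor C = M₂.cFactor C := by
  have := Fintype.ofFinite (D v)
  funext o
  rw [← sum_cFactor_insert hv hch, h, sum_cFactor_insert hv hch]

/-- Sinks can be summed out of `A ∪ B` one at a time; if this has determined the factor of one side,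
the factor of the other side is obtained by division. -/
theorem cFactor_eq_of_union (hpos : ∀ o, 0 < M₁.cFactor Set.univ o) (hAB : Disjoint A B)
    (hadj : ∀ a ∈ A, ∀ b ∈ B, ¬ H.bidirected.Adj a b)
    (h : M₁.cFactor (A ∪ B) = M₂.cFactor (A ∪ B)) :
    M₁.cFactor A = M₂.cFactor A ∧ M₁.cFactor B = M₂.cFactor B := by
  induction hS : A ∪ B using WellFoundedLT.induction generalizing A B with
  | _ S ih =>
    subst hS
    rcases (A ∪ B).eq_empty_or_nonempty with hAB₀ | hne
    · obtain ⟨rfl, rfl⟩ := Set.union_empty_iff.1 hAB₀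
      simpa using h
    obtain ⟨v, hv, hsink⟩ := H.exists_sink hne
    wlog hvA : v ∈ A generalizing A B
    · rw [Set.union_comm] at h ih hne hv hsink
      exact (this hAB.symm (fun b hb a ha hab => hadj a ha b hb hab.symm) h ih hne hv hsink
        (hv.resolve_right hvA)).symm
    have hvB : v ∉ B := Set.disjoint_left.1 hAB hvA
    have hins : insert v (A \ {v} ∪ B) = A ∪ B := by
      rw [← Set.insert_union, Set.insert_sdiff_singleton, Set.insert_eq_of_mem hvA]
    have hvAB : v ∉ A \ {v} ∪ B := by simp [hvB]
    have hB : M₁.cFactor B = M₂.cFactor B :=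
      (ih (A \ {v} ∪ B) (hins ▸ Set.ssubset_insert hvAB) (hAB.mono_left Set.sdiff_subset)
        (fun a ha => hadj a ha.1) (cFactor_eq_of_insert hvAB
          (fun w hw => hsink w (hins ▸ .inr hw)) (hins ▸ h)) rfl).2
    exact ⟨cFactor_eq_of_union_of_eq hpos hAB hadj h hB, hB⟩

section Minimal

variable (hT : Minimal (fun T => C ⊆ T ∧ M₁.cFactor T = M₂.cFactor T) T)

include hT

theorem isRooted_of_minimal : H.IsRooted T C := by
  rintro v ⟨hvT, hvC⟩
  by_contra! hsink
  have hle : T ⊆ T \ {v} := hT.le_of_le ⟨Set.subset_sdiff_singleton hT.prop.1 hvC,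
    cFactor_eq_of_insert (v := v) (by simp) (fun w hw => hsink w hw.1) (by
      rw [Set.insert_sdiff_singleton, Set.insert_eq_of_mem hvT, hT.prop.2])⟩ Set.sdiff_subset
  exact (hle hvT).2 rfl

theorem preconnected_of_minimal (hpos : ∀ o, 0 < M₁.cFactor Set.univ o)
    (hC : (H.bidirected.induce C).Preconnected) : (H.bidirected.induce T).Preconnected := by
  refine preconnected_induce_iff.2 fun S hST ⟨s, hs⟩ hne => ?_
  by_contra! hadj
  obtain ⟨hS, hTS⟩ := cFactor_eq_of_union (M₂ := M₂) hpos Set.disjoint_sdiff_right hadj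
    (by rw [Set.union_sdiff_cancel hST, hT.prop.2])
  rcases subset_or_subset_sdiff_of_preconnected hC hT.prop.1 hadj with hCS | hCTS
  · exact hne (hST.antisymm (hT.le_of_le ⟨hCS, hS⟩ hST))
  · exact (hT.le_of_le ⟨hCTS, hTS⟩ Set.sdiff_subset (hST hs)).2 hs

end Minimal

theorem cFactor_eq_of_connected (hpos : ∀ o, 0 < M₁.cFactor Set.univ o)
    (h : M₁.cFactor Set.univ = M₂.cFactor Set.univ) (hH : IsEmpty (H.Hedge X Y))
    (hXY : Disjoint X Y) (hC : (H.bidirected.induce C).Connected)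
    (hCA : C ⊆ H.ancestorsAvoiding X Y)
    (hadj : ∀ a ∈ C, ∀ b ∈ H.ancestorsAvoiding X Y \ C, ¬ H.bidirected.Adj a b) :
    M₁.cFactor C = M₂.cFactor C := by
  obtain ⟨T, -, hT⟩ := (Set.toFinite {T | C ⊆ T ∧ M₁.cFactor T = M₂.cFactor T}).exists_le_minimal
    ⟨Set.subset_univ C, h⟩
  have hrooted := isRooted_of_minimal hT
  have hconn := preconnected_of_minimal hT hpos hC.preconnected
  obtain ⟨c, hc⟩ := hC.nonempty
  have hTX : Disjoint T X := by
    by_contra hTX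
    exact hH.false ⟨C, T, _, hT.prop.1, hCA, DAG.disjoint_ancestorsAvoiding hXY, hrooted,
      DAG.isRooted_ancestorsAvoiding, hC,
      (SimpleGraph.connected_iff _).2 ⟨hconn, ⟨c, hT.prop.1 hc⟩⟩,
      Set.not_disjoint_iff_nonempty_inter.1 hTX⟩
  have hTA := hrooted.subset hTX hCA DAG.mem_ancestorsAvoiding_of_edge
  obtain rfl : C = T := by
    by_contra hne
    obtain ⟨a, ha, b, hb, hab⟩ := preconnected_induce_iff.1 hconn C hT.prop.1 ⟨c, hc⟩ hne
    exact hadj a ha b ⟨hTA hb.1, hb.2⟩ hab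
  exact hT.prop.2

theorem cFactor_eq_of_isEmpty_hedge (hpos : ∀ o, 0 < M₁.cFactor Set.univ o)
    (h : M₁.cFactor Set.univ = M₂.cFactor Set.univ) (hH : IsEmpty (H.Hedge X Y))
    (hXY : Disjoint X Y) (hCA : C ⊆ H.ancestorsAvoiding X Y)
    (hadj : ∀ a ∈ C, ∀ b ∈ H.ancestorsAvoiding X Y \ C, ¬ H.bidirected.Adj a b) :
    M₁.cFactor C = M₂.cFactor C := by
  induction C using WellFoundedLT.induction with
  | _ C ih =>
    rcases C.eq_empty_or_nonempty with rfl | hC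
    · funext o
      simp only [cFactor_empty]
    by_cases hconn : (H.bidirected.induce C).Preconnected
    · exact cFactor_eq_of_connected hpos h hH hXY
        (SimpleGraph.connected_iff _ |>.2 ⟨hconn, hC.to_subtype⟩) hCA hadj
    obtain ⟨S, hSC, hS, hne, hno⟩ : ∃ S ⊆ C, S.Nonempty ∧ S ≠ C ∧
        ∀ a ∈ S, ∀ b ∈ C \ S, ¬ H.bidirected.Adj a b := by
      simpa [preconnected_induce_iff] using hconn
    have hSeq : M₁.cFactor S = M₂.cFactor S := by
      refine ih S (hSC.ssubset_of_ne hne) (hSC.trans hCA) fun a ha b hb hab => ?_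
      by_cases hbC : b ∈ C
      · exact hno a ha b ⟨hbC, hb.2⟩ hab
      · exact hadj a (hSC ha) b ⟨hb.1, hbC⟩ hab
    have hCSeq : M₁.cFactor (C \ S) = M₂.cFactor (C \ S) := by
      refine ih (C \ S) (Set.sdiff_ssubset_left_iff.2 (by rwa [Set.inter_eq_right.2 hSC]))
        (Set.sdiff_subset.trans hCA)
        fun a ha b hb hab => ?_
      by_cases hbC : b ∈ C
      · exact hno b (by_contra fun hbS => hb.2 ⟨hbC, hbS⟩) a ha hab.symm
      · exact hadj a ha.1 b ⟨hb.1, hbC⟩ hab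
    funext o
    rw [← Set.union_sdiff_cancel hSC, cFactor_union Set.disjoint_sdiff_right hno,
      cFactor_union Set.disjoint_sdiff_right hno, hSeq, hCSeq]

theorem measure_solution_eq_of_isEmpty_hedge [∀ v, Nonempty (D v)]
    (hpos : ∀ o, 0 < M₁.cFactor Set.univ o) (h : M₁.cFactor Set.univ = M₂.cFactor Set.univ)
    (hH : IsEmpty (H.Hedge X Y)) (hXY : Disjoint X Y)
    {s₁ : (∀ e, M₁.Ω e) → ∀ v, D v} (hs₁ : M₁.IsSolution X x s₁)
    {s₂ : (∀ e, M₂.Ω e) → ∀ v, D v} (hs₂ : M₂.IsSolution X x s₂) (y : ∀ v, D v) :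
    Measure.pi M₁.law {u | ∀ v ∈ Y, s₁ u v = y v} =
      Measure.pi M₂.law {u | ∀ v ∈ Y, s₂ u v = y v} := by
  classical
  have hAX : Disjoint (H.ancestorsAvoiding X Y) X := DAG.disjoint_ancestorsAvoiding hXY
  have hevent : ∀ {M : LatentModel H D} {s}, M.IsSolution X x s → ∀ a : ∀ v, D v,
      {u | ∀ v ∈ H.ancestorsAvoiding X Y, s u v = a v} =
        M.cEvent (H.ancestorsAvoiding X Y) (X.piecewise x a) := by
    intro M s hs a
    rw [← hs.setOf_eq_cEvent hAX DAG.mem_ancestorsAvoiding_of_edge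
      fun v hv => X.piecewise_eq_of_mem x a hv]
    ext u
    refine forall₂_congr fun v hv => ?_
    rw [X.piecewise_eq_of_notMem x a (Set.disjoint_left.1 hAX hv)]
  refine measure_preimage_eq_of_dependsOn (R := {a | ∀ v ∈ Y, a v = y v})
    (fun a => hevent hs₁ a ▸ M₁.measurableSet_cEvent _ _)
    (fun a => hevent hs₂ a ▸ M₂.measurableSet_cEvent _ _) (fun a => ?_) fun a b hab => ?_
  · rw [hevent hs₁, hevent hs₂]
    exact congrFun (cFactor_eq_of_isEmpty_hedge hpos h hH hXY subset_rfl
      fun a _ b hb => absurd hb.1 hb.2) _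
  · exact propext (forall₂_congr fun v hv => by rw [hab v (DAG.subset_ancestorsAvoiding hv)])

end LatentModel

namespace CausalModel

variable {V : Type} {D : V → Type} {X Z : Set V} {x : ∀ v, D v} {G : SMG V}

/-- A semi-Markovian model that induces `G`, regarded as a latent variable model over `G`. -/
def toLatentModel (M : CausalModel V D) (hM : M.Induces G) : LatentModel G D where
  U := M.U
  Ω := M.Ω
  law := M.law
  paU := M.paU
  f := M.f
  f_congr v a a' u u' h h' := M.f_congr v a a' u u' (fun w hw => h w ((hM.1 w v).2 hw)) h'
  measurableSet_f v a d := M.measurable_f v a (t := {d}) trivial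
  adj v w e hvw hv hw := (hM.2 v w).2 ⟨hvw, e, hv, hw⟩

variable [∀ v, Nonempty (D v)]

open Classical in
/-- An extension to all of `V` of an assignment of values to the variables outside `Z`, with
arbitrary values on `Z`. -/
noncomputable def extend (Z : Set V) (a : ∀ v : {v // v ∉ Z}, D v) : ∀ v, D v :=
  fun v => if hv : v ∉ Z then a ⟨v, hv⟩ else Classical.arbitrary _

theorem extend_apply (Z : Set V) (a : ∀ v : {v // v ∉ Z}, D v) (v : {v // v ∉ Z}) :
    extend Z a v = a v :=
  dif_pos v.2

variable [Finite V]

theorem solution_spec (M : CausalModel V D) (u : ∀ e, M.Ω e) (v : V) :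
    M.solution u v = M.f v (M.solution u) u :=
  (M.existsUnique_solution u).choose_spec.1 v

theorem eq_solution (M : CausalModel V D) {u : ∀ e, M.Ω e} {a : ∀ v, D v}
    (h : ∀ v, a v = M.f v a u) : a = M.solution u :=
  (M.existsUnique_solution u).choose_spec.2 a h

theorem solution_intervene_of_mem (M : CausalModel V D) (x : ∀ v, D v) (u : ∀ e, M.Ω e) {v : V}
    (hv : v ∈ X) : (M.intervene X x).solution u v = x v :=
  ((M.intervene X x).solution_spec u v).trans (if_pos hv)

theorem solution_intervene_of_notMem (M : CausalModel V D) (x : ∀ v, D v) (u : ∀ e, M.Ω e) {v : V}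
    (hv : v ∉ X) :
    (M.intervene X x).solution u v = M.f v ((M.intervene X x).solution u) u :=
  ((M.intervene X x).solution_spec u v).trans (if_neg hv)

theorem eq_solution_intervene (M : CausalModel V D) {u : ∀ e, M.Ω e} {a : ∀ v, D v}
    (hX : ∀ v ∈ X, a v = x v) (h : ∀ v ∉ X, a v = M.f v a u) :
    a = (M.intervene X x).solution u := by
  refine (M.intervene X x).eq_solution fun v => ?_
  by_cases hv : v ∈ X
  · exact (hX v hv).trans (if_pos hv).symm
  · exact (h v hv).trans (if_neg hv).symm

theorem solution_intervene_empty (M : CausalModel V D) (x : ∀ v, D v) (u : ∀ e, M.Ω e) :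
    (M.intervene ∅ x).solution u = M.solution u :=
  (M.eq_solution_intervene (by simp) fun v _ => M.solution_spec u v).symm

theorem causalEffect_empty (M : CausalModel V D) (x : ∀ v, D v) (S : Set V) (s : ∀ v, D v) :
    M.causalEffect ∅ x S s = M.prob S s :=
  congrArg (Measure.pi M.law) (Set.ext fun u =>
    forall₂_congr fun v _ => by rw [M.solution_intervene_empty x u])

theorem measurableSet_solution_eq [∀ v, Finite (D v)] (M : CausalModel V D) (v : V) (d : D v) :
    MeasurableSet {u | M.solution u v = d} := by
  have hsol : ∀ a : ∀ v, D v, MeasurableSet {u | M.solution u = a} := by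
    intro a
    have : {u | M.solution u = a} = ⋂ w, M.f w a ⁻¹' {a w} := by
      ext u
      simp only [Set.mem_ofPred_eq, Set.mem_iInter, Set.mem_preimage, Set.mem_singleton_iff]
      constructor
      · rintro rfl w
        exact (M.solution_spec u w).symm
      · exact fun h => (M.eq_solution fun w => (h w).symm).symm
    rw [this]
    exact .iInter fun w => M.measurable_f w a trivial
  have : {u | M.solution u v = d} = ⋃ a ∈ {a : ∀ v, D v | a v = d}, {u | M.solution u = a} := by
    ext u
    simp
  rw [this]
  exact .biUnion (Set.to_countable _) fun a _ => hsol a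

theorem isSolution_toLatentModel (M : CausalModel V D) (hM : M.Induces G) (X : Set V)
    (x : ∀ v, D v) :
    (M.toLatentModel hM).IsSolution X x fun u => (M.intervene X x).solution u :=
  ⟨fun u _ hv => M.solution_intervene_of_notMem x u hv,
    fun u _ hv => M.solution_intervene_of_mem x u hv⟩

theorem prob_univ_eq_cFactor (M : CausalModel V D) (hM : M.Induces G) (o : ∀ v, D v) :
    M.prob Set.univ o = (M.toLatentModel hM).cFactor Set.univ o := by
  rw [← M.causalEffect_empty o, LatentModel.cFactor,
    ← (M.isSolution_toLatentModel hM ∅ o).setOf_eq_cEvent (by simp) (by simp) (by simp)]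
  rfl

theorem solution_intervene_extend_congr {M : CausalModel V D} (hM : M.Induces G)
    {v : {v // v ∉ Z}} {a a' : ∀ v : {v // v ∉ Z}, D v} {u u' : ∀ e, M.Ω e}
    (ha : ∀ p, (G.latentProjection Z).edge p v → a p = a' p)
    (hu : ∀ e, (∃ w, G.LatentAnc Zᶜ w v ∧ e ∈ M.paU w) → u e = u' e) {w : V}
    (hw : G.LatentAnc Zᶜ w v) :
    (M.intervene (Zᶜ \ {v.1}) (extend Z a)).solution u w =
      (M.intervene (Zᶜ \ {v.1}) (extend Z a')).solution u' w := by
  induction w using G.wellFounded_edge.induction with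
  | _ w ih =>
    have hwv : w ∉ Zᶜ \ {v.1} := fun hn => hn.2 (hw.eq_of_mem hn.1)
    rw [M.solution_intervene_of_notMem _ _ hwv, M.solution_intervene_of_notMem _ _ hwv]
    refine M.f_congr _ _ _ _ _ (fun p hp => ?_) fun e he => hu e ⟨w, hw, he⟩
    have hpw : G.edge p w := (hM.1 p w).2 hp
    by_cases hpZ : p ∈ Z
    · exact ih p hpw (.head ⟨fun h => h hpZ, hpw⟩ hw)
    · have hpv : p ∈ Zᶜ \ {v.1} :=
        ⟨hpZ, fun hpv => DAG.not_edge_of_reflTransGen hw.reflTransGen (hpv ▸ hpw)⟩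
      rw [M.solution_intervene_of_mem _ _ hpv, M.solution_intervene_of_mem _ _ hpv,
        extend_apply Z a ⟨p, hpZ⟩, extend_apply Z a' ⟨p, hpZ⟩]
      exact ha ⟨p, hpZ⟩ (SMG.latentProjection_edge.2 ⟨w, hpw, hw⟩)

variable [∀ v, Finite (D v)]

/-- The latent variable model on the variables outside `Z` that results from a semi-Markovian model
by substituting the functions of the variables in `Z`. The result of these substitutions in the
function of `v` is the value of `v` under the intervention on all other variables outside `Z`. -/
noncomputable def project (M : CausalModel V D) (hM : M.Induces G) (Z : Set V) :
    LatentModel (G.latentProjection Z) (fun v : {v // v ∉ Z} => D v) where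
  U := M.U
  Ω := M.Ω
  law := M.law
  paU v := {e | ∃ w, G.LatentAnc Zᶜ w v ∧ e ∈ M.paU w}
  f v a u := (M.intervene (Zᶜ \ {v.1}) (extend Z a)).solution u v
  f_congr _ _ _ _ _ ha hu := solution_intervene_extend_congr hM ha hu .refl
  measurableSet_f v a d := (M.intervene _ (extend Z a)).measurableSet_solution_eq v d
  adj v w e hvw := by
    rintro ⟨p, hp, hep⟩ ⟨q, hq, heq⟩
    refine SMG.latentProjection_adj.2 ⟨hvw, ?_⟩
    by_cases hpq : p = q
    · subst hpq
      refine .inl ⟨p, ?_, hp, hq⟩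
      by_contra hpZ
      exact hvw (Subtype.ext ((hp.eq_of_mem hpZ).symm.trans (hq.eq_of_mem hpZ)))
    · exact .inr ⟨⟨s(p, q), (hM.2 p q).2 ⟨hpq, e, hep, heq⟩⟩, p, by simp, q, by simp, hp, hq⟩

theorem isSolution_project (M : CausalModel V D) (hM : M.Induces G) (hXZ : Disjoint X Z)
    (x : ∀ v, D v) :
    (M.project hM Z).IsSolution {v | v.1 ∈ X} (fun v => x v)
      fun u v => (M.intervene X x).solution u v := by
  refine ⟨fun u v hv => congrFun (M.eq_solution_intervene (fun w hw => ?_) fun w hw => ?_) v.1,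
    fun u v hv => M.solution_intervene_of_mem x u hv⟩
  · exact (extend_apply Z (fun w => (M.intervene X x).solution u w) ⟨w, hw.1⟩).symm
  · refine M.solution_intervene_of_notMem x u ?_
    by_cases hwv : w = v
    · exact hwv ▸ hv
    · exact Set.disjoint_right.1 hXZ (by_contra fun hwZ => hw ⟨hwZ, hwv⟩)

theorem prob_compl_eq_cFactor (M : CausalModel V D) (hM : M.Induces G) (Z : Set V)
    (o : ∀ v, D v) : M.prob Zᶜ o = (M.project hM Z).cFactor Set.univ fun v => o v := by
  rw [← M.causalEffect_empty o, LatentModel.cFactor,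
    ← (M.isSolution_project hM (Set.empty_disjoint Z) o).setOf_eq_cEvent (by simp) (by simp)
      (by simp)]
  exact congrArg (Measure.pi M.law) (Set.ext fun u =>
    ⟨fun h v _ => h v v.2, fun h v hv => h ⟨v, hv⟩ trivial⟩)

end CausalModel

namespace SMG

variable {V : Type} [Finite V] {G : SMG V} {X Y Z : Set V}

theorem identifiable_of_isEmpty_hedge (hXY : Disjoint X Y) (h : IsEmpty (G.Hedge X Y)) :
    G.Identifiable Set.univ X Y := by
  intro D _ _ M₁ M₂ h₁ h₂ hP hpos x y
  refine LatentModel.measure_solution_eq_of_isEmpty_hedge (fun o => ?_) (funext fun o => ?_) h hXY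
    (M₁.isSolution_toLatentModel h₁ X x) (M₂.isSolution_toLatentModel h₂ X x) y
  · exact M₁.prob_univ_eq_cFactor h₁ o ▸ hpos o
  · rw [← M₁.prob_univ_eq_cFactor, ← M₂.prob_univ_eq_cFactor, hP]

theorem identifiable_compl_of_isEmpty_hedge (hXY : Disjoint X Y) (hXZ : Disjoint X Z)
    (hYZ : Disjoint Y Z)
    (h : IsEmpty ((G.latentProjection Z).Hedge {v | v.1 ∈ X} {v | v.1 ∈ Y})) :
    G.Identifiable Zᶜ X Y := by
  intro D _ _ M₁ M₂ h₁ h₂ hP hpos x y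
  have hcFactor : ∀ (M : CausalModel V D) (hM : M.Induces G) (o : ∀ v : {v // v ∉ Z}, D v),
      (M.project hM Z).cFactor Set.univ o = M.prob Zᶜ (CausalModel.extend Z o) := by
    intro M hM o
    simp only [M.prob_compl_eq_cFactor hM, CausalModel.extend_apply]
  have hY : ∀ a : ∀ v, D v, (∀ v ∈ Y, a v = y v) ↔
      ∀ v ∈ {v : {v // v ∉ Z} | v.1 ∈ Y}, a v = y v := fun a =>
    ⟨fun h v hv => h v hv, fun h v hv => h ⟨v, Set.disjoint_left.1 hYZ hv⟩ hv⟩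
  simp only [CausalModel.causalEffect, CausalModel.prob, hY]
  refine LatentModel.measure_solution_eq_of_isEmpty_hedge (fun o => ?_) (funext fun o => ?_) h
    (hXY.preimage _) (M₁.isSolution_project h₁ hXZ x) (M₂.isSolution_project h₂ hXZ x) fun v => y v
  · exact hcFactor M₁ h₁ o ▸ hpos _
  · rw [hcFactor, hcFactor, hP]

end SMG

/-! ### The parity models -/

theorem card_setOf_map_eq {R M N : Type*} [Ring R] [AddCommGroup M] [Module R M] [AddCommGroup N]
    [Module R N] (φ : M →ₗ[R] N) (a₀ : M) : Nat.card {a | φ a = φ a₀} = Nat.card φ.ker :=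
  Nat.card_congr ((Equiv.subRight a₀).subtypeEquiv fun a => by simp [sub_eq_zero])

theorem card_setOf_eq_of_card_range_eq {R M N P : Type*} [Ring R] [AddCommGroup M] [Module R M]
    [Finite M] [AddCommGroup N] [Module R N] [AddCommGroup P] [Module R P] (φ : M →ₗ[R] N)
    (ψ : M →ₗ[R] P) (h : Nat.card φ.range = Nat.card ψ.range) {b : N} {c : P}
    (hbc : b ∈ φ.range ↔ c ∈ ψ.range) : Nat.card {a | φ a = b} = Nat.card {a | ψ a = c} := by
  by_cases hb : b ∈ φ.range
  · obtain ⟨a, rfl⟩ := hb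
    obtain ⟨a', rfl⟩ := hbc.1 ⟨a, rfl⟩
    have hφ := φ.ker.card_eq_card_quotient_mul_card
    have hψ := ψ.ker.card_eq_card_quotient_mul_card
    rw [Nat.card_congr φ.quotKerEquivRange.toEquiv, h] at hφ
    rw [Nat.card_congr ψ.quotKerEquivRange.toEquiv] at hψ
    have : Finite ψ.range := (Set.finite_range ψ).to_subtype
    rw [card_setOf_map_eq, card_setOf_map_eq]
    exact Nat.eq_of_mul_eq_mul_right Nat.card_pos (hφ.symm.trans hψ)
  · have hφ : {a | φ a = b} = ∅ := Set.eq_empty_of_forall_notMem fun a ha => hb ⟨a, ha⟩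
    have hψ : {a | ψ a = c} = ∅ := Set.eq_empty_of_forall_notMem fun a ha => hb (hbc.2 ⟨a, ha⟩)
    simp [hφ, hψ]

section Boundary

variable {V : Type*} [Fintype V] {G : SimpleGraph V} {C S T : Set V} {g : V → ZMod 2}
  {u u' : Sym2 V → ZMod 2} {v : V}

open Classical in
/-- The boundary, with coefficients in `ZMod 2`, of a set of edges of `G`, of which those that leave
`S` are ignored. Subsets of `Sym2 V` and of `V` are encoded as functions to `ZMod 2`. -/
noncomputable def edgeBoundary (G : SimpleGraph V) (S : Set V) :
    (Sym2 V → ZMod 2) →ₗ[ZMod 2] V → ZMod 2 :=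
  ((G.induce S).spanningCoe.incMatrix (ZMod 2)).mulVecLin

open Classical in
theorem edgeBoundary_apply : edgeBoundary G S u v =
    ∑ e, if e ∈ (G.induce S).spanningCoe.incidenceSet v then u e else 0 := by
  simp [edgeBoundary, Matrix.mulVec, dotProduct, SimpleGraph.incMatrix_apply']

theorem edgeBoundary_congr (hu : ∀ e ∈ G.incidenceSet v, (∀ w ∈ e, w ∈ S) → u e = u' e) :
    edgeBoundary G S u v = edgeBoundary G S u' v := by
  simp only [edgeBoundary_apply]
  refine Finset.sum_congr rfl fun e _ => ?_
  split_ifs with he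
  · obtain ⟨hadj, hv⟩ := he
    induction e with
    | _ a b =>
      have hab : G.Adj a b ∧ a ∈ S ∧ b ∈ S := by simpa using hadj
      exact hu _ ⟨hab.1, hv⟩ (by simp [hab])
  · rfl

theorem edgeBoundary_of_notMem (hv : v ∉ S) : edgeBoundary G S u v = 0 := by
  rw [edgeBoundary_congr (u' := 0) fun e he hS => absurd (hS v he.2) hv]
  simp

theorem sum_edgeBoundary (G : SimpleGraph V) (S : Set V) (u : Sym2 V → ZMod 2) :
    ∑ v, edgeBoundary G S u v = 0 := by
  classical
  simp only [edgeBoundary, Matrix.mulVecLin_apply, Matrix.mulVec, dotProduct]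
  rw [Finset.sum_comm]
  refine Finset.sum_eq_zero fun e _ => ?_
  rw [← Finset.sum_mul]
  by_cases he : e ∈ (G.induce S).spanningCoe.edgeSet
  · rw [SimpleGraph.sum_incMatrix_apply_of_mem_edgeSet _ he, CharTwo.two_eq_zero (R := ZMod 2),
      zero_mul]
  · rw [SimpleGraph.sum_incMatrix_apply_of_notMem_edgeSet _ he, zero_mul]

open Classical in
theorem edgeBoundary_single {a b : V} (ha : a ∈ S) (hb : b ∈ S) (hab : G.Adj a b) :
    edgeBoundary G S (Pi.single s(a, b) 1) = Pi.single a 1 - Pi.single b 1 := by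
  ext v
  have hne := hab.ne
  rcases eq_or_ne v a with rfl | hva <;> rcases eq_or_ne v b with rfl | hvb <;>
    simp_all [edgeBoundary, SimpleGraph.incMatrix_apply', SimpleGraph.mk'_mem_incidenceSet_iff]

open Classical in
theorem single_sub_single_mem_range_edgeBoundary (hS : (G.induce S).Preconnected) {a b : V}
    (ha : a ∈ S) (hb : b ∈ S) :
    Pi.single a 1 - Pi.single b 1 ∈ (edgeBoundary G S).range := by
  suffices ∀ c : S, Relation.ReflTransGen (G.induce S).Adj ⟨a, ha⟩ c →
      Pi.single a 1 - Pi.single c.1 1 ∈ (edgeBoundary G S).range from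
    this ⟨b, hb⟩ ((SimpleGraph.reachable_iff_reflTransGen _ _).1 (hS _ _))
  intro c hc
  induction hc with
  | refl => simp
  | @tail c d _ hcd ih =>
    rw [← sub_add_sub_cancel]
    exact add_mem ih ⟨_, edgeBoundary_single c.2 d.2 hcd⟩

theorem mem_range_edgeBoundary_iff (hS : (G.induce S).Preconnected) :
    g ∈ (edgeBoundary G S).range ↔ (∀ v ∉ S, g v = 0) ∧ ∑ v, g v = 0 := by
  classical
  constructor
  · rintro ⟨u, rfl⟩
    exact ⟨fun v hv => edgeBoundary_of_notMem hv, sum_edgeBoundary G S u⟩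
  · rintro ⟨hg, hsum⟩
    rcases S.eq_empty_or_nonempty with rfl | ⟨c, hc⟩
    · obtain rfl : g = 0 := funext fun v => hg v (Set.notMem_empty v)
      exact zero_mem _
    have hg' : g = ∑ v, g v • (Pi.single v 1 - Pi.single c 1) := by
      simp only [smul_sub, Finset.sum_sub_distrib, ← Finset.sum_smul, hsum, zero_smul, sub_zero]
      exact pi_eq_sum_univ' g
    rw [hg']
    refine sum_mem fun v _ => ?_
    by_cases hv : v ∈ S
    · exact Submodule.smul_mem _ _ (single_sub_single_mem_range_edgeBoundary hS hv hc)
    · simp [hg v hv]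

theorem exists_edgeBoundary_eq (hC : C.Nonempty) (hCT : C ⊆ T) (hT : (G.induce T).Preconnected)
    (g : V → ZMod 2) : ∃ u, ∀ v ∈ T \ C, edgeBoundary G T u v = g v := by
  classical
  obtain ⟨c, hc⟩ := hC
  obtain ⟨u, hu⟩ := (mem_range_edgeBoundary_iff hT
    (g := (T \ C).indicator g - (∑ v, (T \ C).indicator g v) • Pi.single c 1)).2
    ⟨fun v hv => by
      have hvc : v ≠ c := by rintro rfl; exact hv (hCT hc)
      simp [hv, hvc], by simp [← Finset.mul_sum]⟩
  refine ⟨u, fun v hv => ?_⟩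
  have hvc : v ≠ c := by rintro rfl; exact hv.2 hc
  simp [hu, hv, hvc]

open Classical in
/-- The boundary at the vertices outside `C` of the edges inside `T`, and at the vertices in `C` of
the edges inside `C`. -/
noncomputable def splitBoundary (G : SimpleGraph V) (C T : Set V) :
    (Sym2 V → ZMod 2) →ₗ[ZMod 2] V → ZMod 2 :=
  .pi fun v => .proj v ∘ₗ edgeBoundary G (if v ∈ C then C else T)

open Classical in
theorem splitBoundary_apply :
    splitBoundary G C T u v = edgeBoundary G (if v ∈ C then C else T) u v := rfl

open Classical in
theorem mem_range_splitBoundary_iff (hCT : C ⊆ T) (hC : (G.induce C).Connected)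
    (hT : (G.induce T).Preconnected) :
    g ∈ (splitBoundary G C T).range ↔ (∀ v ∉ T, g v = 0) ∧ ∑ v with v ∈ C, g v = 0 := by
  constructor
  · rintro ⟨u, rfl⟩
    refine ⟨fun v hv => ?_, ?_⟩
    · rw [splitBoundary_apply, if_neg fun h => hv (hCT h), edgeBoundary_of_notMem hv]
    · rw [← sum_edgeBoundary G C u, Finset.sum_filter]
      refine Finset.sum_congr rfl fun v _ => ?_
      split_ifs with hv
      · rw [splitBoundary_apply, if_pos hv]
      · rw [edgeBoundary_of_notMem hv]
  · rintro ⟨hg, hsum⟩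
    obtain ⟨u, hu⟩ := (mem_range_edgeBoundary_iff hC.preconnected (g := C.indicator g)).2
      ⟨fun v hv => Set.indicator_of_notMem hv g, by
        simpa only [Finset.sum_filter, Set.indicator_apply] using hsum⟩
    obtain ⟨u', hu'⟩ := exists_edgeBoundary_eq (Set.nonempty_coe_sort.1 hC.nonempty) hCT hT g
    refine ⟨fun e => if ∀ w ∈ e, w ∈ C then u e else u' e, funext fun v => ?_⟩
    rw [splitBoundary_apply]
    split_ifs with hv
    · rw [edgeBoundary_congr fun e _ he => if_pos he, hu, Set.indicator_of_mem hv]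
    · rw [edgeBoundary_congr fun e he _ => if_neg fun h => hv (h v he.2)]
      by_cases hvT : v ∈ T
      · exact hu' v ⟨hvT, hv⟩
      · rw [edgeBoundary_of_notMem hvT, hg v hvT]

theorem card_range_edgeBoundary_eq (hCT : C ⊆ T) (hC : (G.induce C).Connected)
    (hT : (G.induce T).Preconnected) :
    Nat.card (edgeBoundary G T).range = Nat.card (splitBoundary G C T).range := by
  classical
  obtain ⟨c, hc⟩ := hC.nonempty
  let φ : Module.Dual (ZMod 2) (V → ZMod 2) := ∑ v with v ∉ C, .proj v
  have hφ : φ (Pi.single c 1) = 0 := by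
    simp [φ, hc]
  -- Adding the values outside `C` to the value at `c` turns the sum over `C` into the sum over `V`.
  let κ := LinearEquiv.transvection hφ
  have hκ : ∀ g, κ g = g + φ g • Pi.single c 1 := fun g => rfl
  refine Nat.card_congr (κ.toEquiv.subtypeEquiv fun g => ?_)
  rw [LinearEquiv.coe_toEquiv, mem_range_edgeBoundary_iff hT, mem_range_splitBoundary_iff hCT hC hT]
  refine and_congr (forall₂_congr fun v hv => ?_) ?_
  · have hvc : v ≠ c := by rintro rfl; exact hv (hCT hc)
    simp [hκ, hvc]
  · rw [← Finset.sum_filter_add_sum_filter_not Finset.univ (· ∈ C) g]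
    simp [hκ, φ, Finset.sum_add_distrib, ← Finset.mul_sum, hc]

open Classical in
theorem card_setOf_edgeBoundary_eq (hCT : C ⊆ T) (hC : (G.induce C).Connected)
    (hT : (G.induce T).Preconnected) {g' : V → ZMod 2} (hg : ∀ v ∉ T, g v = 0)
    (hg' : ∀ v ∉ T, g' v = 0) (h : ∑ v, g v = ∑ v with v ∈ C, g' v) :
    Nat.card {u | edgeBoundary G T u = g} = Nat.card {u | splitBoundary G C T u = g'} := by
  refine card_setOf_eq_of_card_range_eq _ _ (card_range_edgeBoundary_eq hCT hC hT) ?_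
  rw [mem_range_edgeBoundary_iff hT, mem_range_splitBoundary_iff hCT hC hT, h]
  exact and_congr_left fun _ => ⟨fun _ => hg', fun _ => hg⟩

end Boundary

namespace DAG.IsRooted

variable {W : Type} {K : DAG W} {S R : Set W}

open Classical in
/-- A child in `S` of a vertex in `S \ R`. The value at other vertices is irrelevant. -/
noncomputable def child (h : K.IsRooted S R) (v : W) : W :=
  if hv : v ∈ S \ R then (h v hv).choose else v

theorem child_mem (h : K.IsRooted S R) {v : W} (hv : v ∈ S \ R) : h.child v ∈ S := by
  rw [child, dif_pos hv]
  exact (h v hv).choose_spec.1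

theorem edge_child (h : K.IsRooted S R) {v : W} (hv : v ∈ S \ R) : K.edge v (h.child v) := by
  rw [child, dif_pos hv]
  exact (h v hv).choose_spec.2

variable [Fintype W]

open Classical in
/-- The sum of the values of `a` at those vertices in `S \ R` whose chosen child is `v`. -/
noncomputable def parentSum {M : Type*} [AddCommMonoid M] (h : K.IsRooted S R) (a : W → M)
    (v : W) : M :=
  ∑ w with w ∈ S \ R ∧ h.child w = v, a w

section AddCommMonoid

variable {M : Type*} [AddCommMonoid M] {a a' : W → M} {v t : W}

theorem parentSum_congr (h : K.IsRooted S R) (ha : ∀ w ∈ S \ R, K.edge w v → a w = a' w) :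
    h.parentSum a v = h.parentSum a' v := by
  classical
  refine Finset.sum_congr rfl fun w hw => ?_
  obtain ⟨hwS, rfl⟩ := (Finset.mem_filter.1 hw).2
  exact ha w hwS (h.edge_child hwS)

theorem parentSum_of_notMem (h : K.IsRooted S R) (a : W → M) (hv : v ∉ S) :
    h.parentSum a v = 0 := by
  classical
  rw [parentSum, Finset.filter_false_of_mem, Finset.sum_empty]
  rintro w - ⟨hw, rfl⟩
  exact hv (h.child_mem hw)

open Classical in
theorem sum_parentSum (h : K.IsRooted S R) (a : W → M) :
    ∑ v, h.parentSum a v = ∑ v with v ∈ S \ R, a v := by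
  simp only [parentSum, ← Finset.filter_filter]
  exact Finset.sum_fiberwise _ _ _

theorem transGen_of_parentSum_ne_zero (h : K.IsRooted S R)
    (ha : ∀ v ∈ S \ R, a v ≠ 0 → v = t ∨ h.parentSum a v ≠ 0) (hv : h.parentSum a v ≠ 0) :
    Relation.TransGen K.edge t v := by
  classical
  induction v using K.wellFounded_edge.induction with
  | _ v ih =>
    obtain ⟨w, hw, haw⟩ := Finset.exists_ne_zero_of_sum_ne_zero hv
    obtain ⟨hwS, rfl⟩ := (Finset.mem_filter.1 hw).2
    have hedge := h.edge_child hwS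
    obtain rfl | hw := ha w hwS haw
    · exact .single hedge
    · exact (ih w hedge hw).tail hedge

end AddCommMonoid

open Classical in
theorem sum_inter_parentSum_add {M : Type*} [AddCommGroup M] {a b : W → M} (h : K.IsRooted S R)
    (ha : ∀ v ∈ S \ R, a v = h.parentSum a v + b v) :
    ∑ v with v ∈ S ∩ R, (h.parentSum a v + b v) = ∑ v with v ∈ S, b v := by
  have hsum : ∑ v with v ∈ S, h.parentSum a v = ∑ v with v ∈ S \ R, a v := by
    rw [← h.sum_parentSum, Finset.sum_filter_of_ne]
    exact fun v _ hv => not_imp_comm.1 (h.parentSum_of_notMem a) hv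
  have hsplit : ∑ v with v ∈ S, (h.parentSum a v + b v) =
      ∑ v with v ∈ S ∩ R, (h.parentSum a v + b v) + ∑ v with v ∈ S \ R, a v := by
    rw [Finset.sum_congr rfl fun v hv => ha v (Finset.mem_filter.1 hv).2]
    simp only [Set.mem_inter_iff, Set.mem_sdiff, ← Finset.filter_filter,
      Finset.sum_filter_add_sum_filter_not]
  rw [Finset.sum_add_distrib, hsum, add_comm] at hsplit
  exact (add_right_cancel hsplit).symm

end DAG.IsRooted

theorem measure_pi_eq_of_card_eq {ι κ α : Type*} [Fintype ι] [Fintype κ] [Finite α]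
    [MeasurableSpace α] [MeasurableSingletonClass α] (μ : ι ⊕ κ → Measure α)
    [∀ e, SigmaFinite (μ e)] {c : ι → ℝ≥0∞} (hc : ∀ i b, μ (.inl i) {b} = c i)
    {S S' : Set (ι ⊕ κ → α)}
    (h : ∀ r : κ → α, Nat.card {u | Sum.elim u r ∈ S} = Nat.card {u | Sum.elim u r ∈ S'}) :
    Measure.pi μ S = Measure.pi μ S' := by
  classical
  have := Fintype.ofFinite α
  have hsingleton (u : ι → α) (r : κ → α) :
      Measure.pi μ {Sum.elim u r} = (∏ i, c i) * ∏ k, μ (.inr k) {r k} := by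
    simp [Measure.pi_singleton, hc]
  have hpi (S : Set (ι ⊕ κ → α)) : Measure.pi μ S = ∑ r : κ → α,
      Nat.card {u | Sum.elim u r ∈ S} * ((∏ i, c i) * ∏ k, μ (.inr k) {r k}) := by
    rw [← lintegral_indicator_one S.toFinite.measurableSet, lintegral_fintype,
      ← (Equiv.sumArrowEquivProdArrow ι κ α).symm.sum_comp, Fintype.sum_prod_type_right]
    refine Finset.sum_congr rfl fun r _ => ?_
    change ∑ u, S.indicator 1 (Sum.elim u r) * Measure.pi μ {Sum.elim u r} = _
    simp [hsingleton, Set.indicator_apply, ← Finset.sum_filter, Finset.sum_const,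
      Nat.card_eq_fintype_card, Fintype.card_subtype]
  rw [hpi, hpi]
  exact Finset.sum_congr rfl fun r _ => by rw [h r]

/-- The unobserved bits of the parity models: one for each pair of vertices, a private one for each
vertex, and a noise bit for each vertex. -/
abbrev ParityBit (W : Type) : Type := Sym2 W ⊕ W ⊕ W

namespace ParityBit

variable {W : Type}

/-- The laws of the bits: all are uniform but for the noise bits, which have the law `ν`. -/
noncomputable def law (ν : Measure (ZMod 2)) : ParityBit W → Measure (ZMod 2) :=
  Sum.elim (fun _ => ProbabilityTheory.uniformOn Set.univ)
    (Sum.elim (fun _ => ProbabilityTheory.uniformOn Set.univ) fun _ => ν)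

instance (ν : Measure (ZMod 2)) [IsProbabilityMeasure ν] (e : ParityBit W) :
    IsProbabilityMeasure (law ν e) := by
  rcases e with _ | _ | _
  · exact ProbabilityTheory.instIsProbabilityMeasure_uniformOn_univ
  · exact ProbabilityTheory.instIsProbabilityMeasure_uniformOn_univ
  · assumption

theorem uniformOn_univ_singleton (b : ZMod 2) :
    ProbabilityTheory.uniformOn Set.univ {b} = (2⁻¹ : ℝ≥0∞) := by
  simp [ProbabilityTheory.uniformOn_univ]

variable [Fintype W]

theorem pi_law_singleton_ne_zero {ν : Measure (ZMod 2)} [IsProbabilityMeasure ν]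
    (hν : ∀ b, ν {b} ≠ 0) (u : ParityBit W → ZMod 2) : Measure.pi (law ν) {u} ≠ 0 := by
  classical
  rw [Measure.pi_singleton, Finset.prod_ne_zero_iff]
  rintro (_ | _ | _) -
  · simp [law, uniformOn_univ_singleton]
  · simp [law, uniformOn_univ_singleton]
  · exact hν _

theorem pi_law_iUnion_noise_le (ν : Measure (ZMod 2)) [IsProbabilityMeasure ν] :
    Measure.pi (law ν) (⋃ v : W, {u | u (.inr (.inr v)) = 1}) ≤ Fintype.card W * ν {1} := by
  classical
  refine (measure_iUnion_fintype_le _ _).trans ?_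
  have hpi (v : W) : Measure.pi (law ν) {u | u (.inr (.inr v)) = 1} = ν {1} :=
    (measurePreserving_eval (law ν) (.inr (.inr v))).measure_preimage
      (measurableSet_singleton (1 : ZMod 2)).nullMeasurableSet
  simp [hpi]

variable (W) in
theorem exists_noise : ∃ ν : Measure (ZMod 2), ∃ _ : IsProbabilityMeasure ν, (∀ b, ν {b} ≠ 0) ∧
    Fintype.card W * ν {1} < Measure.pi (law (W := W) ν) {0} := by
  classical
  obtain ⟨δ, hδ₀, hδ⟩ := ENNReal.exists_nnreal_pos_mul_lt (a := Fintype.card W)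
    (b := 2⁻¹ ^ Fintype.card (ParityBit W)) (by simp) (by simp)
  let ε : ℝ≥0∞ := min δ 2⁻¹
  have hε : ε ≤ 2⁻¹ := min_le_right _ _
  have hε' : 2⁻¹ ≤ 1 - ε := by
    rw [← ENNReal.one_sub_inv_two]
    exact tsub_le_tsub_left hε 1
  let ν : Measure (ZMod 2) := (1 - ε) • Measure.dirac 0 + ε • Measure.dirac 1
  have hν₀ : ν {0} = 1 - ε := by simp [ν]
  have hν₁ : ν {1} = ε := by simp [ν]
  have hν : IsProbabilityMeasure ν :=
    ⟨by simp [ν, tsub_add_cancel_of_le (hε.trans (ENNReal.inv_le_one.2 one_le_two))]⟩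
  refine ⟨ν, hν, fun b => ?_, ?_⟩
  · fin_cases b
    · exact hν₀.trans_ne (pos_of_ne_zero (by simp) |>.trans_le hε').ne'
    · exact hν₁.trans_ne (lt_min (by simpa using hδ₀) (by simp)).ne'
  · rw [hν₁]
    calc Fintype.card W * ε ≤ δ * Fintype.card W := by
          rw [mul_comm]
          gcongr
          exact min_le_left _ _
      _ < 2⁻¹ ^ Fintype.card (ParityBit W) := hδ
      _ ≤ Measure.pi (law ν) {0} := by
        rw [Measure.pi_singleton, ← Finset.card_univ, ← Finset.prod_const]
        refine Finset.prod_le_prod' fun e _ => ?_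
        rcases e with _ | _ | _
        · simp [law, uniformOn_univ_singleton]
        · simp [law, uniformOn_univ_singleton]
        · exact hε'.trans_eq hν₀.symm

end ParityBit

namespace SMG.Hedge

variable {W : Type} {H : SMG W} {X Y : Set W}

theorem C_subset_compl_X (h : H.Hedge X Y) : h.C ⊆ Xᶜ :=
  fun _ hv => Set.disjoint_left.1 h.disjoint_A_X (h.C_subset_A hv)

variable [Fintype W]

/-- The boundary of the edge bits that enters the functions of the two parity models. In the model
`false`, the vertices in `C` ignore the edges that leave `C`. -/
noncomputable def boundary (h : H.Hedge X Y) :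
    Bool → (Sym2 W → ZMod 2) →ₗ[ZMod 2] W → ZMod 2
  | true => edgeBoundary H.bidirected h.T
  | false => splitBoundary H.bidirected h.C h.T

open Classical in
/-- The sum of the bits of the parents in `T` that enters the functions of the two parity models. In
the model `false`, the vertices in `C` ignore their parents in `T`. -/
noncomputable def input (h : H.Hedge X Y) : Bool → (W → ZMod 2) → W → ZMod 2
  | true, a, v => h.isRooted_T.parentSum a v
  | false, a, v => if v ∈ h.C then 0 else h.isRooted_T.parentSum a v

/-- The bit that each vertex in `T` computes in the two parity models. The vertices outside `C` pass
it on inside `T` as their first bit, those in `C` pass it on inside `A` as their second bit. -/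
noncomputable def signal (h : H.Hedge X Y) (i : Bool) (a : W → ZMod 2 × ZMod 2)
    (u : ParityBit W → ZMod 2) (v : W) : ZMod 2 :=
  h.input i (fun w => (a w).1) v + h.boundary i (fun e => u (.inl e)) v

open Classical in
/-- The functions of the two parity models. -/
noncomputable def fn (h : H.Hedge X Y) (i : Bool) (v : W) (a : W → ZMod 2 × ZMod 2)
    (u : ParityBit W → ZMod 2) : ZMod 2 × ZMod 2 :=
  (if v ∈ h.T \ h.C then h.signal i a u v else u (.inr (.inl v)),
    h.isRooted_A.parentSum (fun w => (a w).2) v +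
      ((if v ∈ h.C then h.signal i a u v else 0) + u (.inr (.inr v))))

variable (H) in
/-- The unobserved bits on which the functions of the parity models depend. -/
def parityBits (v : W) : Set (ParityBit W) :=
  {e | Sum.elim (· ∈ H.bidirected.incidenceSet v) (Sum.elim (· = v) (· = v)) e}

theorem boundary_congr (h : H.Hedge X Y) (i : Bool) {u u' : Sym2 W → ZMod 2} {v : W}
    (hu : ∀ e ∈ H.bidirected.incidenceSet v, u e = u' e) :
    h.boundary i u v = h.boundary i u' v := by
  cases i
  · change splitBoundary H.bidirected h.C h.T u v = splitBoundary H.bidirected h.C h.T u' v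
    simp only [splitBoundary_apply]
    exact edgeBoundary_congr fun e he _ => hu e he
  · exact edgeBoundary_congr fun e he _ => hu e he

theorem boundary_of_notMem (h : H.Hedge X Y) (i : Bool) {u : Sym2 W → ZMod 2} {v : W}
    (hv : v ∉ h.T) : h.boundary i u v = 0 := by
  cases i
  · change splitBoundary H.bidirected h.C h.T u v = 0
    rw [splitBoundary_apply, if_neg fun hC => hv (h.C_subset_T hC), edgeBoundary_of_notMem hv]
  · exact edgeBoundary_of_notMem hv

theorem input_congr (h : H.Hedge X Y) (i : Bool) {a a' : W → ZMod 2} {v : W}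
    (ha : ∀ w, H.edge w v → a w = a' w) : h.input i a v = h.input i a' v := by
  cases i <;> simp only [input, h.isRooted_T.parentSum_congr fun w _ => ha w]

theorem input_of_notMem (h : H.Hedge X Y) (i : Bool) {a : W → ZMod 2} {v : W}
    (hv : v ∉ h.T) : h.input i a v = 0 := by
  cases i <;> simp [input, h.isRooted_T.parentSum_of_notMem a hv]

theorem fn_congr (h : H.Hedge X Y) (i : Bool) (v : W) (a a' : W → ZMod 2 × ZMod 2)
    (u u' : ParityBit W → ZMod 2) (ha : ∀ w, H.edge w v → a w = a' w)
    (hu : ∀ e ∈ parityBits H v, u e = u' e) : h.fn i v a u = h.fn i v a' u' := by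
  have hsignal : h.signal i a u v = h.signal i a' u' v := congrArg₂ _
    (h.input_congr i fun w hw => congrArg Prod.fst (ha w hw))
    (h.boundary_congr i fun e he => hu (.inl e) he)
  rw [fn, hsignal, h.isRooted_A.parentSum_congr fun w _ hw => congrArg Prod.snd (ha w hw),
    hu (.inr (.inl v)) rfl, hu (.inr (.inr v)) rfl, fn]

/-- Two models, for `i : Bool`, that witness that the causal effect is not identifiable if there is
a hedge. Every observed variable consists of two bits. -/
noncomputable def parityModel (h : H.Hedge X Y) (ν : Measure (ZMod 2)) [IsProbabilityMeasure ν]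
    (i : Bool) : CausalModel W (fun _ => ZMod 2 × ZMod 2) where
  U := ParityBit W
  Ω _ := ZMod 2
  law := ParityBit.law ν
  paV v := {w | H.edge w v}
  paU := parityBits H
  f := h.fn i
  f_congr := h.fn_congr i
  measurable_f _ _ := fun _ _ => (Set.toFinite _).measurableSet
  acyclic := H.acyclic
  card_children e := by
    rcases e with e | v | v
    · induction e with
      | _ a b =>
        calc {v | s(a, b) ∈ H.bidirected.incidenceSet v}.encard
            ≤ ({a, b} : Set W).encard := Set.encard_le_encard fun v hv => Sym2.mem_iff.1 hv.2
          _ ≤ 2 := Set.encard_insert_le _ _ |>.trans (by rw [Set.encard_singleton]; norm_num)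
    · exact (Set.encard_le_one_iff.2 fun _ _ ha hb => Eq.trans (Eq.symm ha) hb).trans one_le_two
    · exact (Set.encard_le_one_iff.2 fun _ _ ha hb => Eq.trans (Eq.symm ha) hb).trans one_le_two

theorem induces_parityModel (h : H.Hedge X Y) (ν : Measure (ZMod 2)) [IsProbabilityMeasure ν]
    (i : Bool) : (h.parityModel ν i).Induces H := by
  refine ⟨fun a b => Iff.rfl, fun a b => ⟨fun hab => ⟨hab.ne, .inl s(a, b), ?_, ?_⟩, ?_⟩⟩
  · exact ⟨hab, Sym2.mem_mk_left a b⟩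
  · exact ⟨hab, Sym2.mem_mk_right a b⟩
  · rintro ⟨hne, e | v | v, ha, hb⟩
    · exact H.bidirected.adj_of_mem_incidenceSet hne ha hb
    · exact absurd (Eq.trans (Eq.symm ha) hb) hne
    · exact absurd (Eq.trans (Eq.symm ha) hb) hne

/-- The values `r` of the private and the noise bits are compatible with the values `o` of the
observed variables in the parity models. -/
def Compatible (h : H.Hedge X Y) (o : W → ZMod 2 × ZMod 2) (r : W ⊕ W → ZMod 2) : Prop :=
  (∀ v ∉ h.T \ h.C, r (.inl v) = (o v).1) ∧
    ∀ v ∉ h.C, h.isRooted_A.parentSum (fun w => (o w).2) v + r (.inr v) = (o v).2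

open Classical in
/-- The values of the signals in the parity models, as determined by the values of the observed
variables and of the noise bits. -/
noncomputable def observedSignal (h : H.Hedge X Y) (o : W → ZMod 2 × ZMod 2) (r : W ⊕ W → ZMod 2)
    (v : W) : ZMod 2 :=
  if v ∈ h.C then (o v).2 - h.isRooted_A.parentSum (fun w => (o w).2) v - r (.inr v)
  else if v ∈ h.T then (o v).1 else 0

theorem forall_fn_eq_iff (h : H.Hedge X Y) (i : Bool) (o : W → ZMod 2 × ZMod 2)
    (u : Sym2 W → ZMod 2) (r : W ⊕ W → ZMod 2) :
    (∀ v, h.fn i v o (Sum.elim u r) = o v) ↔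
      h.Compatible o r ∧ h.boundary i u = h.observedSignal o r - h.input i fun w => (o w).1 := by
  rw [Compatible, funext_iff, ← forall_and, ← forall_and]
  refine forall_congr' fun v => ?_
  rw [Pi.sub_apply, eq_sub_iff_add_eq', Prod.ext_iff]
  change _ ∧ _ ↔ _ ∧ h.signal i o (Sum.elim u r) v = _
  by_cases hC : v ∈ h.C
  · simp only [fn, observedSignal, hC, Set.mem_sdiff, not_true_eq_false, and_false, if_true,
      if_false, not_false_eq_true, forall_const, IsEmpty.forall_iff, and_true, Sum.elim_inr]
    refine and_congr_right fun _ => ⟨fun hv => ?_, fun hv => ?_⟩ <;> linear_combination hv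
  · by_cases hT : v ∈ h.T
    · simp [fn, observedSignal, hC, hT, and_comm]
    · simp [fn, observedSignal, signal, hC, hT, h.input_of_notMem, h.boundary_of_notMem]

open Classical in
theorem sum_observedSignal_sub_input (h : H.Hedge X Y) (o : W → ZMod 2 × ZMod 2)
    (r : W ⊕ W → ZMod 2) :
    ∑ v, (h.observedSignal o r - h.input true fun w => (o w).1) v =
      ∑ v with v ∈ h.C, (h.observedSignal o r - h.input false fun w => (o w).1) v := by
  have hinput : ∑ v, h.input true (fun w => (o w).1) v = ∑ v with v ∈ h.T \ h.C, (o v).1 :=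
    h.isRooted_T.sum_parentSum _
  have hsignal : ∑ v with v ∉ h.C, h.observedSignal o r v = ∑ v with v ∈ h.T \ h.C, (o v).1 := by
    simp only [Finset.sum_filter]
    refine Finset.sum_congr rfl fun v _ => ?_
    by_cases hC : v ∈ h.C <;> by_cases hT : v ∈ h.T <;> simp [observedSignal, hC, hT]
  have hinput' : ∑ v with v ∈ h.C, h.input false (fun w => (o w).1) v = 0 :=
    Finset.sum_eq_zero fun v hv => if_pos (Finset.mem_filter.1 hv).2
  simp only [Pi.sub_apply, Finset.sum_sub_distrib]
  rw [hinput, hinput', ← hsignal, ← Finset.sum_filter_add_sum_filter_not _ (· ∈ h.C)]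
  ring

theorem prob_univ_parityModel (h : H.Hedge X Y) (ν : Measure (ZMod 2)) [IsProbabilityMeasure ν]
    (i : Bool) (o : W → ZMod 2 × ZMod 2) : (h.parityModel ν i).prob Set.univ o =
      Measure.pi (ParityBit.law ν) {u | ∀ v, h.fn i v o u = o v} := by
  rw [CausalModel.prob_univ_eq_cFactor _ (h.induces_parityModel ν i)]
  simp only [LatentModel.cFactor, LatentModel.cEvent, Set.mem_univ, true_imp_iff]
  rfl

theorem prob_parityModel_eq (h : H.Hedge X Y) (ν : Measure (ZMod 2)) [IsProbabilityMeasure ν]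
    (o : W → ZMod 2 × ZMod 2) :
    (h.parityModel ν true).prob Set.univ o = (h.parityModel ν false).prob Set.univ o := by
  rw [prob_univ_parityModel, prob_univ_parityModel]
  refine measure_pi_eq_of_card_eq (ParityBit.law ν)
    (fun _ => ParityBit.uniformOn_univ_singleton) fun r => ?_
  simp only [Set.mem_ofPred_eq, forall_fn_eq_iff]
  by_cases hr : h.Compatible o r
  · simp only [hr, true_and]
    have hzero (i : Bool) (v : W) (hv : v ∉ h.T) :
        (h.observedSignal o r - h.input i fun w => (o w).1) v = 0 := by
      have hC : v ∉ h.C := fun hC => hv (h.C_subset_T hC)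
      simp [observedSignal, hv, hC, h.input_of_notMem]
    exact card_setOf_edgeBoundary_eq h.C_subset_T h.connected_C h.connected_T.preconnected
      (hzero true) (hzero false) (h.sum_observedSignal_sub_input o r)
  · simp only [hr, false_and]

theorem prob_parityModel_pos (h : H.Hedge X Y) {ν : Measure (ZMod 2)} [IsProbabilityMeasure ν]
    (hν : ∀ b, ν {b} ≠ 0) (o : W → ZMod 2 × ZMod 2) :
    0 < (h.parityModel ν true).prob Set.univ o := by
  classical
  rw [prob_univ_parityModel]
  obtain ⟨u, hu⟩ := exists_edgeBoundary_eq (Set.nonempty_coe_sort.1 h.connected_C.nonempty)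
    h.C_subset_T h.connected_T.preconnected fun v => (o v).1 - h.input true (fun w => (o w).1) v
  have hsignal (v : W) (hv : v ∈ h.T \ h.C) (r : W ⊕ W → ZMod 2) :
      h.signal true o (Sum.elim u r) v = (o v).1 :=
    (congrArg₂ _ rfl (hu v hv)).trans (add_sub_cancel _ _)
  let r : W ⊕ W → ZMod 2 := Sum.elim (fun v => (o v).1) fun v =>
    (o v).2 - h.isRooted_A.parentSum (fun w => (o w).2) v -
      if v ∈ h.C then h.signal true o (Sum.elim u 0) v else 0
  refine (pos_iff_ne_zero.2 (ParityBit.pi_law_singleton_ne_zero hν (Sum.elim u r))).trans_le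
    (measure_mono ?_)
  rintro _ rfl v
  refine Prod.ext ?_ ?_
  · change ite _ _ _ = _
    split_ifs with hv
    · exact hsignal v hv r
    · rfl
  · change h.isRooted_A.parentSum (fun w => (o w).2) v +
      ((if v ∈ h.C then h.signal true o (Sum.elim u 0) v else 0) + r (.inr v)) = (o v).2
    simp only [r, Sum.elim_inr]
    ring

open Classical in
theorem sum_A_inter_Y_snd_eq (h : H.Hedge X Y) {i : Bool} {a : W → ZMod 2 × ZMod 2}
    {u : ParityBit W → ZMod 2} (ha : ∀ v ∈ h.A, a v = h.fn i v a u) :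
    ∑ v with v ∈ h.A ∩ Y, (a v).2 =
      ∑ v with v ∈ h.C, h.signal i a u v + ∑ v with v ∈ h.A, u (.inr (.inr v)) := by
  have hsnd (v : W) (hv : v ∈ h.A) := congrArg Prod.snd (ha v hv)
  have hsum := h.isRooted_A.sum_inter_parentSum_add fun v hv => hsnd v hv.1
  rw [Finset.sum_congr rfl fun v hv => hsnd v (Finset.mem_filter.1 hv).2.1]
  refine hsum.trans ?_
  rw [Finset.sum_add_distrib, ← Finset.sum_filter, Finset.filter_filter]
  congr 2
  exact Finset.filter_congr fun v _ => and_iff_right_of_imp fun hv => h.C_subset_A hv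

open Classical in
theorem sum_C_parentSum_eq_one (h : H.Hedge X Y) {a : W → ZMod 2} {t : W} (ht : t ∈ h.T ∩ X)
    (hmax : ∀ v ∈ h.T ∩ X, ¬ Relation.TransGen H.edge t v)
    (haX : ∀ v ∈ X, a v = if v = t then 1 else 0)
    (ha : ∀ v ∈ h.T \ h.C, v ∉ X → a v = h.isRooted_T.parentSum a v) :
    ∑ v with v ∈ h.C, h.isRooted_T.parentSum a v = 1 := by
  have hne (v : W) (hv : v ∈ h.T \ h.C) (hav : a v ≠ 0) :
      v = t ∨ h.isRooted_T.parentSum a v ≠ 0 := by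
    by_cases hX : v ∈ X
    · left
      by_contra hvt
      exact hav (by rw [haX v hX, if_neg hvt])
    · exact .inr (ha v hv hX ▸ hav)
  have hsingle (v : W) (hv : v ∈ h.T \ h.C) :
      a v = h.isRooted_T.parentSum a v + if v = t then 1 else 0 := by
    by_cases hX : v ∈ X
    · rw [haX v hX, right_eq_add]
      by_contra hsum
      exact hmax v ⟨hv.1, hX⟩ (h.isRooted_T.transGen_of_parentSum_ne_zero hne hsum)
    · rw [if_neg (by rintro rfl; exact hX ht.2), add_zero, ← ha v hv hX]
  have htC : t ∉ h.C := fun htC => h.C_subset_compl_X htC ht.2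
  calc ∑ v with v ∈ h.C, h.isRooted_T.parentSum a v
      = ∑ v with v ∈ h.T ∩ h.C, (h.isRooted_T.parentSum a v + if v = t then 1 else 0) := by
        simp [Set.inter_eq_right.2 h.C_subset_T, Finset.sum_add_distrib, htC]
    _ = ∑ v with v ∈ h.T, if v = t then 1 else 0 :=
        h.isRooted_T.sum_inter_parentSum_add hsingle
    _ = 1 := by simp [ht.1]

open Classical in
theorem sum_C_signal_true_eq_one (h : H.Hedge X Y) {a : W → ZMod 2 × ZMod 2} {t : W}
    (ht : t ∈ h.T ∩ X) (hmax : ∀ v ∈ h.T ∩ X, ¬ Relation.TransGen H.edge t v)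
    (haX : ∀ v ∈ X, a v = (if v = t then 1 else 0, 0)) (ha : ∀ v ∉ X, a v = h.fn true v a 0) :
    ∑ v with v ∈ h.C, h.signal true a 0 v = 1 := by
  have hsignal (v : W) : h.signal true a 0 v = h.isRooted_T.parentSum (fun w => (a w).1) v :=
    (congrArg₂ _ rfl (congrFun (map_zero (h.boundary true)) v)).trans (add_zero _)
  simp only [hsignal]
  refine h.sum_C_parentSum_eq_one ht hmax (fun v hv => by rw [haX v hv]) fun v hv hX => ?_
  rw [← hsignal]
  exact (congrArg Prod.fst (ha v hX)).trans (if_pos hv)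

open Classical in
theorem sum_C_signal_false (h : H.Hedge X Y) (a : W → ZMod 2 × ZMod 2) (u : ParityBit W → ZMod 2) :
    ∑ v with v ∈ h.C, h.signal false a u v = 0 := by
  rw [← sum_edgeBoundary H.bidirected h.C fun e => u (.inl e), Finset.sum_filter]
  refine Finset.sum_congr rfl fun v _ => ?_
  split_ifs with hv
  · simp [signal, input, boundary, splitBoundary_apply, hv]
  · exact (edgeBoundary_of_notMem hv).symm

open Classical in
theorem exists_noise_eq_one (h : H.Hedge X Y) {a : W → ZMod 2 × ZMod 2} {u : ParityBit W → ZMod 2}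
    (ha : ∀ v ∈ h.A, a v = h.fn false v a u) (hsum : ∑ v with v ∈ h.A ∩ Y, (a v).2 = 1) :
    ∃ v, u (.inr (.inr v)) = 1 := by
  rw [h.sum_A_inter_Y_snd_eq ha, h.sum_C_signal_false, zero_add] at hsum
  obtain ⟨v, -, hv⟩ := Finset.exists_ne_zero_of_sum_ne_zero (hsum.trans_ne one_ne_zero)
  exact ⟨v, Fin.eq_one_of_ne_zero _ hv⟩

theorem exists_causalEffect_parityModel_ne (h : H.Hedge X Y) {ν : Measure (ZMod 2)}
    [IsProbabilityMeasure ν]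
    (hν : Fintype.card W * ν {1} < Measure.pi (ParityBit.law (W := W) ν) {0}) :
    ∃ x y, (h.parityModel ν true).causalEffect X x Y y ≠
      (h.parityModel ν false).causalEffect X x Y y := by
  classical
  obtain ⟨t, ht, hmax⟩ := H.wellFounded_swap_transGen.has_min _ h.nonempty_T_inter_X
  let x : W → ZMod 2 × ZMod 2 := fun v => (if v = t then 1 else 0, 0)
  let s (i : Bool) (u : ParityBit W → ZMod 2) : W → ZMod 2 × ZMod 2 :=
    ((h.parityModel ν i).intervene X x).solution u
  have hsX (i u) (v : W) (hv : v ∈ X) : s i u v = x v :=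
    (h.parityModel ν i).solution_intervene_of_mem x u hv
  have hs (i u) (v : W) (hv : v ∉ X) : s i u v = h.fn i v (s i u) u :=
    (h.parityModel ν i).solution_intervene_of_notMem x u hv
  have hsA (i u) (v : W) (hv : v ∈ h.A) : s i u v = h.fn i v (s i u) u :=
    hs i u v (Set.disjoint_left.1 h.disjoint_A_X hv)
  let R : Set (W → ZMod 2 × ZMod 2) := {a | ∑ v with v ∈ h.A ∩ Y, (a v).2 = 1}
  have htrue : {0} ⊆ s true ⁻¹' R := by
    rintro _ rfl
    refine (h.sum_A_inter_Y_snd_eq (hsA true 0)).trans ?_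
    rw [h.sum_C_signal_true_eq_one ht hmax (hsX true 0) (hs true 0)]
    simp
  have hfalse : s false ⁻¹' R ⊆ ⋃ v : W, {u | u (.inr (.inr v)) = 1} := fun u hu =>
    Set.mem_iUnion.2 (h.exists_noise_eq_one (hsA false u) hu)
  by_contra! heq
  have hR : DependsOn (· ∈ R) Y := fun a a' haa' => propext <| Eq.congr_left <|
    Finset.sum_congr rfl fun v hv => congrArg Prod.snd (haa' v (Finset.mem_filter.1 hv).2.2)
  have hmeas (i : Bool) (y : W → ZMod 2 × ZMod 2) : MeasurableSet {u | ∀ v ∈ Y, s i u v = y v} :=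
    (Set.toFinite _).measurableSet
  refine absurd ?_ hν.not_ge
  calc Measure.pi (ParityBit.law ν) {0}
      ≤ Measure.pi (ParityBit.law ν) (s true ⁻¹' R) := measure_mono htrue
    _ = Measure.pi (ParityBit.law ν) (s false ⁻¹' R) :=
        measure_preimage_eq_of_dependsOn (hmeas true) (hmeas false) (heq x) hR
    _ ≤ Measure.pi (ParityBit.law ν) (⋃ v : W, {u | u (.inr (.inr v)) = 1}) := measure_mono hfalse
    _ ≤ Fintype.card W * ν {1} := ParityBit.pi_law_iUnion_noise_le ν

theorem exists_models {W : Type} [Finite W] {H : SMG W} {X Y : Set W} (h : H.Hedge X Y) :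
    ∃ M₁ M₂ : CausalModel W (fun _ => ZMod 2 × ZMod 2),
      (M₁.Induces H ∧ ∀ e, Finite (M₁.Ω e) ∧ MeasurableSingletonClass (M₁.Ω e)) ∧
      (M₂.Induces H ∧ ∀ e, Finite (M₂.Ω e) ∧ MeasurableSingletonClass (M₂.Ω e)) ∧
      (∀ o, M₁.prob Set.univ o = M₂.prob Set.univ o) ∧ (∀ o, 0 < M₁.prob Set.univ o) ∧
      ∃ x y, M₁.causalEffect X x Y y ≠ M₂.causalEffect X x Y y := by
  have := Fintype.ofFinite W
  obtain ⟨ν, _, hν, hνW⟩ := ParityBit.exists_noise W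
  have hbit : Finite (ZMod 2) ∧ MeasurableSingletonClass (ZMod 2) := ⟨inferInstance, inferInstance⟩
  exact ⟨h.parityModel ν true, h.parityModel ν false, ⟨h.induces_parityModel ν true, fun _ => hbit⟩,
    ⟨h.induces_parityModel ν false, fun _ => hbit⟩, h.prob_parityModel_eq ν,
    h.prob_parityModel_pos hν, h.exists_causalEffect_parityModel_ne hνW⟩

theorem not_identifiable {W : Type} [Finite W] {H : SMG W} {X Y : Set W} (h : H.Hedge X Y) :
    ¬ H.Identifiable Set.univ X Y := by
  obtain ⟨M₁, M₂, ⟨hM₁, -⟩, ⟨hM₂, -⟩, hprob, hpos, x, y, hne⟩ := h.exists_models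
  exact fun hid => hne (hid _ M₁ M₂ hM₁ hM₂ hprob hpos x y)

end SMG.Hedge

/-! ### Simulation of a model of the latent projection -/

theorem measurePreserving_comp_inl {ι ι' : Type*} [Fintype ι] [Fintype ι'] {Ω : ι ⊕ ι' → Type*}
    [∀ e, MeasurableSpace (Ω e)] (law : ∀ e, Measure (Ω e)) [∀ e, IsProbabilityMeasure (law e)] :
    MeasurePreserving (fun (u : ∀ e, Ω e) (e : ι) => u (.inl e)) (Measure.pi law)
      (Measure.pi fun e => law (.inl e)) :=
  measurePreserving_fst.comp (measurePreserving_sumPiEquivProdPi law)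

theorem encard_setOf_mem_sym2_le_two {α : Type*} (s : Sym2 α) : {a | a ∈ s}.encard ≤ 2 := by
  induction s with
  | _ a b =>
    calc {c | c ∈ s(a, b)}.encard = ({a, b} : Set α).encard := by congr 1; ext c; simp
      _ ≤ Set.encard {b} + 1 := Set.encard_insert_le _ _
      _ = 2 := by rw [Set.encard_singleton]; norm_num

namespace SMG

variable {V : Type} {G : SMG V} {Z : Set V}

/-- The vertices in `s` form a possible location, in `G`, of an unobserved variable whose children
in the latent projection of `G` are the vertices in `S`: they are at most two, they are joined by a
bidirected edge, and together they reach all of `S` through latent vertices. -/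
structure IsApexSet (G : SMG V) (Z : Set V) (S : Set {v // v ∉ Z}) (s : Set V) : Prop where
  encard_le_two : s.encard ≤ 2
  pairwise_adj : s.Pairwise G.bidirected.Adj
  exists_latentAnc : ∀ v ∈ S, ∃ w ∈ s, G.LatentAnc Zᶜ w v

theorem exists_isApexSet [Finite V] {S : Set {v // v ∉ Z}} (hcard : S.encard ≤ 2)
    (hadj : S.Pairwise (G.latentProjection Z).bidirected.Adj) : ∃ s, G.IsApexSet Z S s := by
  obtain hS | hS := S.subsingleton_or_nontrivial
  · exact ⟨Subtype.val '' S, (Set.encard_image_le _ _).trans hcard, (hS.image _).pairwise _,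
      fun v hv => ⟨v, Set.mem_image_of_mem _ hv, .refl⟩⟩
  obtain ⟨a, b, hab, rfl⟩ := Set.encard_eq_two.1
    (hcard.antisymm (Order.add_one_le_of_lt (Set.one_lt_encard_iff_nontrivial.2 hS)))
  obtain ⟨-, ⟨z, -, hza, hzb⟩ | ⟨⟨s, hs⟩, w, hw, w', hw', hwa, hwb⟩⟩ :=
    latentProjection_adj.1 (hadj (.inl rfl) (.inr rfl) hab)
  · refine ⟨{z}, by simp, Set.pairwise_singleton _ _, ?_⟩
    rintro v (rfl | rfl)
    exacts [⟨z, rfl, hza⟩, ⟨z, rfl, hzb⟩]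
  · refine ⟨{v | v ∈ s}, encard_setOf_mem_sym2_le_two s, fun v hv v' hv' hne =>
      SimpleGraph.adj_iff_exists_edge.2 ⟨hne, s, hs, hv, hv'⟩, ?_⟩
    rintro v (rfl | rfl)
    exacts [⟨w, hw, hwa⟩, ⟨w', hw', hwb⟩]

section relay

variable {ι : Type*} {T : ι → Type*} [∀ i, Nonempty (T i)] {entry : ι → Set V}
  {msg msg' : ∀ z ∈ Z, ∀ i, T i} {src src' : ∀ i, T i} {v : V} {i : ι}

open Classical in
/-- The value of the signal `i` available at the vertex `v` when each signal `i` has the value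
`src i`, which is visible to the vertices in `entry i` only, and each vertex `z ∈ Z` sends the
message `msg z` on the values of all signals to its children. -/
noncomputable def relay (G : SMG V) (entry : ι → Set V) (msg : ∀ z ∈ Z, ∀ i, T i)
    (src : ∀ i, T i) (v : V) (i : ι) : T i :=
  if v ∈ entry i then src i
  else if h : ∃ z, ∃ _ : z ∈ Z, G.edge z v ∧ ∃ w ∈ entry i, G.LatentAnc Zᶜ w z then
    msg h.choose h.choose_spec.choose i
  else Classical.arbitrary _

theorem relay_congr (hmsg : ∀ z (hz : z ∈ Z), G.edge z v → msg z hz = msg' z hz)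
    (hsrc : v ∈ entry i → src i = src' i) :
    G.relay entry msg src v i = G.relay entry msg' src' v i := by
  unfold relay
  split_ifs with hv hz
  · exact hsrc hv
  · rw [hmsg _ _ hz.choose_spec.choose_spec.1]
  · rfl

theorem relay_eq (hi : ∃ w ∈ entry i, G.LatentAnc Zᶜ w v)
    (hmsg : ∀ z (hz : z ∈ Z), G.edge z v → (∃ w ∈ entry i, G.LatentAnc Zᶜ w z) →
      msg z hz i = src i) :
    G.relay entry msg src v i = src i := by
  unfold relay
  split_ifs with hv hz
  · rfl
  · exact hmsg _ _ hz.choose_spec.choose_spec.1 hz.choose_spec.choose_spec.2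
  · obtain ⟨w, hw, hwv⟩ := hi
    rcases Relation.ReflTransGen.cases_tail hwv with rfl | ⟨z, hwz, hzZ, hzv⟩
    · exact absurd hw hv
    · exact absurd ⟨z, not_not.1 hzZ, hzv, w, hw, hwz⟩ hz

end relay

end SMG

section PadDom

variable {E F : Type} {Ω : E → Type}

/-- The domains `Ω` of a family of variables, together with one-point domains indexed by `F`. -/
def PadDom (F : Type) (Ω : E → Type) : E ⊕ F → Type :=
  Sum.elim Ω fun _ => Unit

instance [∀ e, Finite (Ω e)] : ∀ e, Finite (PadDom F Ω e) :=
  Sum.rec (fun e => inferInstanceAs (Finite (Ω e))) fun _ => inferInstanceAs (Finite Unit)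

variable [∀ e, MeasurableSpace (Ω e)]

instance : ∀ e, MeasurableSpace (PadDom F Ω e) :=
  Sum.rec (fun e => inferInstanceAs (MeasurableSpace (Ω e))) fun _ => ⊤

instance [∀ e, MeasurableSingletonClass (Ω e)] : ∀ e, MeasurableSingletonClass (PadDom F Ω e) :=
  Sum.rec (fun e => inferInstanceAs (MeasurableSingletonClass (Ω e))) fun _ => ⟨fun _ => trivial⟩

/-- The laws of a family of variables, together with those of constants indexed by `F`. -/
noncomputable def padLaw (F : Type) (law : ∀ e, Measure (Ω e)) :
    ∀ e : E ⊕ F, Measure (PadDom F Ω e) :=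
  Sum.rec law fun _ => Measure.dirac (α := Unit) ()

instance (law : ∀ e, Measure (Ω e)) [∀ e, IsProbabilityMeasure (law e)] :
    ∀ e, IsProbabilityMeasure (padLaw F law e) :=
  Sum.rec (fun e => inferInstanceAs (IsProbabilityMeasure (law e)))
    fun _ => inferInstanceAs (IsProbabilityMeasure (Measure.dirac (α := Unit) ()))

theorem measurePreserving_padLaw [Fintype E] [Fintype F] (law : ∀ e, Measure (Ω e))
    [∀ e, IsProbabilityMeasure (law e)] :
    MeasurePreserving (fun (u : ∀ e, PadDom F Ω e) (e : E) => (u (.inl e) : Ω e))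
      (Measure.pi (padLaw F law)) (Measure.pi law) :=
  measurePreserving_comp_inl (padLaw F law)

end PadDom

/-- The domains of a model of a graph that simulates a model, with domains `D`, of a latent
projection: a vertex in `Z` holds a message in `C`. -/
abbrev LiftDom {V : Type} {Z : Set V} (D : {v // v ∉ Z} → Type) (C : Type) (v : V) : Type :=
  (v ∈ Z → C) × ∀ hv : v ∉ Z, D ⟨v, hv⟩

namespace CausalModel

variable {V : Type} {G : SMG V} {Z : Set V} {D : {v // v ∉ Z} → Type} {C : Type}

theorem exists_forall_isApexSet [Finite V] {M : CausalModel {v // v ∉ Z} D}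
    (hM : M.Induces (G.latentProjection Z)) :
    ∃ apex : M.U → Set V, ∀ e, G.IsApexSet Z {v | e ∈ M.paU v} (apex e) :=
  Classical.skolem.1 fun e => SMG.exists_isApexSet (M.card_children e)
    fun a ha b hb hab => (hM.2 a b).2 ⟨hab, e, ha, hb⟩

instance (M : CausalModel {v // v ∉ Z} D) (e : M.U) : Nonempty (M.Ω e) :=
  (M.law e).nonempty_of_neZero

/-- The values of the observed and unobserved variables of a simulated model, as available at the
vertex `v` of the simulating one; `get` decodes the messages. -/
noncomputable def relayed {E : Type} {Ω : E → Type} [∀ v, Nonempty (D v)] [∀ e, Nonempty (Ω e)]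
    (G : SMG V) (get : C → (∀ v, D v) × (∀ e, Ω e)) (apex : E → Set V) (a : ∀ v, LiftDom D C v)
    (u : ∀ e, Ω e) (v : V) : (∀ v, D v) × (∀ e, Ω e) :=
  (G.relay (fun b => {w | G.edge b w}) (fun z hz => (get ((a z).1 hz)).1) (fun b => (a b).2 b.2) v,
    G.relay apex (fun z hz => (get ((a z).1 hz)).2) u v)

section relayed

variable {E : Type} {Ω : E → Type} [∀ v, Nonempty (D v)] [∀ e, Nonempty (Ω e)]
  {get : C → (∀ v, D v) × (∀ e, Ω e)} {apex : E → Set V} {a a' : ∀ v, LiftDom D C v}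
  {u u' : ∀ e, Ω e} {v : V}

theorem relayed_congr (ha : ∀ w, G.edge w v → a w = a' w) (hu : ∀ e, v ∈ apex e → u e = u' e) :
    relayed G get apex a u v = relayed G get apex a' u' v := by
  unfold relayed
  exact congrArg₂ Prod.mk
    (funext fun b => SMG.relay_congr (fun z _ hzv => by rw [ha z hzv]) fun hb => by rw [ha b hb])
    (funext fun e => SMG.relay_congr (fun z _ hzv => by rw [ha z hzv]) (hu e))

theorem relayed_fst_eq {b : {v // v ∉ Z}} (hb : ∃ w, G.edge b w ∧ G.LatentAnc Zᶜ w v)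
    (hmsg : ∀ z (hz : z ∈ Z), G.edge z v → (∃ w, G.edge b w ∧ G.LatentAnc Zᶜ w z) →
      (get ((a z).1 hz)).1 b = (a b).2 b.2) :
    (relayed G get apex a u v).1 b = (a b).2 b.2 :=
  SMG.relay_eq (entry := fun b : {v // v ∉ Z} => {w | G.edge b w}) (src := fun b => (a b).2 b.2)
    hb hmsg

theorem relayed_snd_eq {e : E} (he : ∃ w ∈ apex e, G.LatentAnc Zᶜ w v)
    (hmsg : ∀ z (hz : z ∈ Z), G.edge z v → (∃ w ∈ apex e, G.LatentAnc Zᶜ w z) →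
      (get ((a z).1 hz)).2 e = u e) :
    (relayed G get apex a u v).2 e = u e :=
  SMG.relay_eq he hmsg

end relayed

variable [Finite V] [∀ v, Nonempty (D v)]

theorem eq_solution_intervene_of_relayed {M : CausalModel {v // v ∉ Z} D}
    (hM : M.Induces (G.latentProjection Z)) {get : C → (∀ v, D v) × (∀ e, M.Ω e)}
    {apex : M.U → Set V} (hapex : ∀ e, G.IsApexSet Z {v | e ∈ M.paU v} (apex e)) {X : Set V}
    {x a : ∀ v, LiftDom D C v} {u : ∀ e, M.Ω e} (hX : ∀ v ∈ X, a v = x v)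
    (hZ : ∀ z (hz : z ∈ Z), get ((a z).1 hz) = relayed G get apex a u z)
    (hO : ∀ v : {v // v ∉ Z}, v.1 ∉ X →
      (a v).2 v.2 = M.f v (relayed G get apex a u v).1 (relayed G get apex a u v).2) :
    (fun v : {v // v ∉ Z} => (a v).2 v.2) =
      (M.intervene {v | v.1 ∈ X} fun v => (x v).2 v.2).solution u := by
  have msg_eq : ∀ z (hz : z ∈ Z),
      (∀ b : {v // v ∉ Z}, (∃ w, G.edge b w ∧ G.LatentAnc Zᶜ w z) →
        (get ((a z).1 hz)).1 b = (a b).2 b.2) ∧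
      ∀ e, (∃ w ∈ apex e, G.LatentAnc Zᶜ w z) → (get ((a z).1 hz)).2 e = u e := by
    intro z
    induction z using G.wellFounded_edge.induction with
    | _ z ih =>
    intro hz
    rw [hZ z hz]
    exact ⟨fun b hb => relayed_fst_eq hb fun z' hz' hzz' hb' => (ih z' hzz' hz').1 b hb',
      fun e he => relayed_snd_eq he fun z' hz' hzz' he' => (ih z' hzz' hz').2 e he'⟩
  refine M.eq_solution_intervene (fun v hv => by rw [hX v hv]) fun v hv => (hO v hv).trans ?_
  refine M.f_congr _ _ _ _ _ (fun b hb => ?_) fun e he => ?_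
  · exact relayed_fst_eq (SMG.latentProjection_edge.1 ((hM.1 b v).2 hb))
      fun z hz _ hb => (msg_eq z hz).1 b hb
  · exact relayed_snd_eq ((hapex e).exists_latentAnc v he) fun z hz _ he => (msg_eq z hz).2 e he

section lift

variable (M : CausalModel {v // v ∉ Z} D) [∀ e, Finite (M.Ω e)]
  [∀ e, MeasurableSingletonClass (M.Ω e)] {get : C → (∀ v, D v) × (∀ e, M.Ω e)}
  (hget : get.Surjective) {apex : M.U → Set V}
  (hapex : ∀ e, G.IsApexSet Z {v | e ∈ M.paU v} (apex e))

/-- The model of `G` that simulates a model `M` of a latent projection of `G`: the variables in `Z`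
hold messages with the values of the observed and unobserved variables of `M`. A constant
unobserved variable for each bidirected edge makes the simulating model induce all of `G`. -/
noncomputable def lift : CausalModel V (LiftDom D C) where
  U := M.U ⊕ G.bidirected.edgeSet
  fintypeU := letI := Fintype.ofFinite G.bidirected.edgeSet; inferInstance
  Ω := PadDom G.bidirected.edgeSet M.Ω
  law := padLaw G.bidirected.edgeSet M.law
  paV v := {w | G.edge w v}
  paU v := {e | Sum.elim (fun e => v ∈ apex e) (fun b => v ∈ (b : Sym2 V)) e}
  f v a u :=
    let r := relayed G get apex a (fun e => u (.inl e)) v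
    (fun _ => Function.surjInv hget r, fun hv => M.f ⟨v, hv⟩ r.1 r.2)
  f_congr v a a' u u' ha hu := by
    have hr : relayed G get apex a (fun e => u (.inl e)) v =
        relayed G get apex a' (fun e => u' (.inl e)) v :=
      relayed_congr ha fun e he => hu (.inl e) he
    simp only [hr]
  measurable_f v a _ _ := (Set.toFinite _).measurableSet
  acyclic := G.acyclic
  card_children e := by
    rcases e with e | b
    exacts [(hapex e).encard_le_two, encard_setOf_mem_sym2_le_two (b : Sym2 V)]

theorem induces_lift : (M.lift hget hapex).Induces G := by
  refine ⟨fun a b => Iff.rfl, fun a b => ⟨fun hab => ⟨hab.ne, .inr ⟨s(a, b), hab⟩, ?_, ?_⟩, ?_⟩⟩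
  · exact Sym2.mem_mk_left a b
  · exact Sym2.mem_mk_right a b
  · rintro ⟨hne, e | ⟨s, hs⟩, ha, hb⟩
    · exact (hapex e).pairwise_adj ha hb hne
    · exact SimpleGraph.adj_iff_exists_edge.2 ⟨hne, s, hs, ha, hb⟩

variable [Nonempty C] (hM : M.Induces (G.latentProjection Z)) {X Y : Set V}
include hM

theorem solution_intervene_lift (hXZ : Disjoint X Z) (x : ∀ v, LiftDom D C v)
    (u : ∀ e, (M.lift hget hapex).Ω e) (v : {v // v ∉ Z}) :
    (((M.lift hget hapex).intervene X x).solution u v).2 v.2 =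
      (M.intervene {v | v.1 ∈ X} fun v => (x v).2 v.2).solution (fun e => u (.inl e)) v := by
  let L := M.lift hget hapex
  refine congrFun (eq_solution_intervene_of_relayed hM hapex (get := get)
    (a := (L.intervene X x).solution u)
    (fun v hv => L.solution_intervene_of_mem x u hv) (fun z hz => ?_) fun v hv => ?_) v
  · rw [L.solution_intervene_of_notMem x u (Set.disjoint_right.1 hXZ hz)]
    exact Function.surjInv_eq hget _
  · exact congrFun (congrArg Prod.snd (L.solution_intervene_of_notMem x u hv)) v.2

theorem causalEffect_lift (hXZ : Disjoint X Z) (hYZ : Disjoint Y Z) (x y : ∀ v, LiftDom D C v) :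
    (M.lift hget hapex).causalEffect X x Y y =
      M.causalEffect {v | v.1 ∈ X} (fun v => (x v).2 v.2) {v | v.1 ∈ Y}
        fun v => (y v).2 v.2 := by
  let _ := Fintype.ofFinite G.bidirected.edgeSet
  have notMem : ∀ v ∈ Y, v ∉ Z := fun v hv => Set.disjoint_left.1 hYZ hv
  have hext : ∀ v (p q : LiftDom D C v) (hv : v ∉ Z), p = q ↔ p.2 hv = q.2 hv := fun v p q hv =>
    ⟨fun h => h ▸ rfl, fun h => Prod.ext (funext fun hz => absurd hz hv) (funext fun _ => h)⟩
  refine Eq.trans (congrArg (Measure.pi (padLaw G.bidirected.edgeSet M.law)) (Set.ext fun u => ?_))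
    ((measurePreserving_padLaw M.law).measure_preimage
      (Set.toFinite _).measurableSet.nullMeasurableSet)
  refine ⟨fun h v hv => ?_, fun h v hv => (hext v _ _ (notMem v hv)).2 ?_⟩
  · exact (M.solution_intervene_lift hget hapex hM hXZ x u v).symm.trans
      ((hext v _ _ v.2).1 (h v hv))
  · exact (M.solution_intervene_lift hget hapex hM hXZ x u ⟨v, notMem v hv⟩).trans
      (h ⟨v, notMem v hv⟩ hv)

theorem prob_lift (o : ∀ v, LiftDom D C v) :
    (M.lift hget hapex).prob Zᶜ o = M.prob Set.univ fun v => (o v).2 v.2 := by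
  have huniv : {v : {v // v ∉ Z} | v.1 ∈ Zᶜ} = Set.univ := Set.eq_univ_of_forall fun v => v.2
  have hempty : {v : {v // v ∉ Z} | v.1 ∈ (∅ : Set V)} = ∅ := rfl
  rw [← causalEffect_empty _ o, M.causalEffect_lift hget hapex hM (Set.empty_disjoint Z)
    disjoint_compl_left, huniv, hempty, causalEffect_empty]

end lift

end CausalModel

theorem SMG.Hedge.not_identifiable_compl {V : Type} [Finite V] {G : SMG V} {X Y Z : Set V}
    (hXZ : Disjoint X Z) (hYZ : Disjoint Y Z)
    (h : (G.latentProjection Z).Hedge {v | v.1 ∈ X} {v | v.1 ∈ Y}) :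
    ¬ G.Identifiable Zᶜ X Y := by
  obtain ⟨M₁, M₂, ⟨hM₁, hfin₁⟩, ⟨hM₂, hfin₂⟩, hprob, hpos, x, y, hne⟩ := h.exists_models
  have := fun e => (hfin₁ e).1
  have := fun e => (hfin₁ e).2
  have := fun e => (hfin₂ e).1
  have := fun e => (hfin₂ e).2
  let C := (({v // v ∉ Z} → ZMod 2 × ZMod 2) × (∀ e, M₁.Ω e)) × (∀ e, M₂.Ω e)
  obtain ⟨apex₁, hapex₁⟩ := CausalModel.exists_forall_isApexSet hM₁
  obtain ⟨apex₂, hapex₂⟩ := CausalModel.exists_forall_isApexSet hM₂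
  have hget₁ : Function.Surjective (Prod.fst : C → _) := Prod.fst_surjective
  have hget₂ : Function.Surjective (Prod.map Prod.fst id : C → _) :=
    Prod.fst_surjective.prodMap Function.surjective_id
  let lift (x : {v // v ∉ Z} → ZMod 2 × ZMod 2) (v : V) : LiftDom (fun _ => ZMod 2 × ZMod 2) C v :=
    (fun _ => Classical.arbitrary C, fun hv => x ⟨v, hv⟩)
  intro hid
  have heq := hid _ (M₁.lift hget₁ hapex₁) (M₂.lift hget₂ hapex₂)
    (M₁.induces_lift hget₁ hapex₁) (M₂.induces_lift hget₂ hapex₂)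
    (fun o => by rw [M₁.prob_lift hget₁ hapex₁ hM₁, M₂.prob_lift hget₂ hapex₂ hM₂, hprob])
    (fun o => by rw [M₁.prob_lift hget₁ hapex₁ hM₁]; exact hpos _) (lift x) (lift y)
  rw [M₁.causalEffect_lift hget₁ hapex₁ hM₁ hXZ hYZ,
    M₂.causalEffect_lift hget₂ hapex₂ hM₂ hXZ hYZ] at heq
  exact hne heq

theorem mainTheorem6 {V : Type} [Finite V] (G : SMG V) (X Y Z : Set V)
    (hXY : Disjoint X Y) (hXZ : Disjoint X Z) (hYZ : Disjoint Y Z) :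
    (G.latentProjection Z).Identifiable Set.univ {v | v.1 ∈ X} {v | v.1 ∈ Y} ↔
      G.Identifiable Zᶜ X Y := by
  constructor
  · exact fun hid => SMG.identifiable_compl_of_isEmpty_hedge hXY hXZ hYZ
      ⟨fun h => h.not_identifiable hid⟩
  · exact fun hid => SMG.identifiable_of_isEmpty_hedge (hXY.preimage Subtype.val)
      ⟨fun h => h.not_identifiable_compl hXZ hYZ hid⟩
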